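/- For a finite simple undirected graph $G=(V,E)$, let $\mathcal{MG}(G)$ denote the random matching produced by the following procedure: as long as edges remain, select an edge $e$ uniformly at random from all remaining edges, add $e$ to the matching, and delete $e$ together with every remaining edge sharing an endpoint with $e$. Let $G(g,r)$ denote the family of all finite nonempty $r$-regular graphs of girth (length of a shortest cycle) at least $g$. Then for every $g\ge 4$ and $r\ge 3$, $$\frac{1-(r-1)^{-\frac{r}{r-2}}}{2}-\frac{r(r-1)^{\lfloor\frac{g-2}{2}\rfloor}}{\left(\lfloor\frac{g-2}{2}\rfloor\right)!}\;\le\;\inf_{G\in G(g,r)}\mathbb{E}\left[\frac{|\mathcal{MG}(G)|}{|V|}\right]\;\le\;\sup_{G\in G(g,r)}\mathbb{E}\left[\frac{|\mathcal{MG}(G)|}{|V|}\right]\;\le\;\frac{1-(r-1)^{-\frac{r}{r-2}}}{2}+\frac{r(r-1)^{\lfloor\frac{g-2}{2}\rfloor}}{\left(\lfloor\frac{g-2}{2}\rfloor\right)!}.$$ -/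

import Mathlib

/-- The edges of `E` that survive the selection of `e`: those sharing no endpoint with `e`.
In particular `e` itself does not survive. -/
noncomputable def survivingEdges {V : Type*} (E : Finset (Sym2 V)) (e : Sym2 V) :
    Finset (Sym2 V) :=
  open Classical in E.filter fun f => ∀ v, v ∈ f → v ∉ e

theorem card_survivingEdges_lt {V : Type*} {E : Finset (Sym2 V)} {e : Sym2 V} (he : e ∈ E) :
    (survivingEdges E e).card < E.card := by
  classical
  refine Finset.card_lt_card ?_
  unfold survivingEdges
  rw [Finset.filter_ssubset]
  refine ⟨e, he, ?_⟩
  intro h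
  obtain ⟨a, b⟩ := e
  exact h a (Sym2.mem_mk_left a b) (Sym2.mem_mk_left a b)

open Classical in
/-- The law of the random set of edges produced by the greedy algorithm when `E` is the set of
remaining edges: if `E` is empty, stop; otherwise select `e ∈ E` uniformly at random, delete all
edges having an endpoint in common with `e`, run the algorithm on what remains, and add `e` to
the outcome. -/
noncomputable def greedyMatchingFrom {V : Type*} (E : Finset (Sym2 V)) :
    PMF (Finset (Sym2 V)) :=
  if h : E.Nonempty then
    (PMF.uniformOfFinset E h).bindOnSupport fun e he =>
      have : (survivingEdges E e).card < E.card :=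
        card_survivingEdges_lt ((PMF.mem_support_uniformOfFinset_iff h e).1 he)
      (greedyMatchingFrom (survivingEdges E e)).map (insert e)
  else PMF.pure ∅
termination_by E.card

/-- The law of the uniformly random greedy matching of a finite graph. -/
noncomputable def greedyMatching {V : Type*} [Fintype V] (G : SimpleGraph V) :
    PMF (Finset (Sym2 V)) :=
  open Classical in greedyMatchingFrom G.edgeFinset

/-- The expectation of (size of the random greedy matching of `G`) / (number of nodes of `G`). -/
noncomputable def expectedGreedyMatchingRatio {V : Type*} [Fintype V] (G : SimpleGraph V) : ℝ :=
  ∑ M : Finset (Sym2 V), (greedyMatching G M).toReal * ((M.card : ℝ) / (Fintype.card V : ℝ))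

universe u

open Classical in
/-- The family of all finite nonempty `r`-regular (simple) graphs of girth at least `g`. -/
structure RegularGirthGraph (g r : ℕ) where
  V : Type u
  [fintypeV : Fintype V]
  [nonemptyV : Nonempty V]
  graph : SimpleGraph V
  regular : graph.IsRegularOfDegree r
  le_girth : (g : ℕ∞) ≤ graph.egirth

attribute [instance] RegularGirthGraph.fintypeV RegularGirthGraph.nonemptyV

/-! Give the edges independent uniform arrival times in `(0, 1]` and accept each arriving edge whose
endpoints are both still free. This has the law of the greedy matching as far as a single vertex is
concerned (`unmatchedProb_eq_weightMeasure_real`). Since a matching of size m covers 2m vertices,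
the expected ratio is the average over `v` of (1 - P(`v` unmatched)) / 2, so a bound at each vertex
suffices.

A vertex `w` is free before time `t` iff no edge `wx` arriving at some time s < t finds `x` free
before s (`free_iff`). Cutting this recursion off at depth n, with "free" as the default, bounds the
event from above for even n and from below for odd n. When 2n < girth, the branches explored use
disjoint sets of edges, hence are independent, and the truncated event has the probability of the
regular tree: `rootProb r n`, computed from f_{n+1}(t) = (1 - ∫₀ᵗ f_n)^(r-1), f_0 = 1
(`weightMeasure_real_branches`).

This iteration reverses order, so its fixed point is also squeezed between consecutive iterates. The
fixed point is y^(r-1), where y' = -y^(r-1) and y(0) = 1, that is y = (1 + (r-2)t)^(-1/(r-2)); at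
the root it gives y(1)^r = (r-1)^(-r/(r-2)). The true probability and the limit thus lie between the
same two iterates, whose gap is at most r(r-1)^n/(n+1)! by a Picard estimate.

The inequality inf ≤ sup needs the family to be nonempty, which a Cayley graph of permutations of a
ball in the tree shows. -/

open MeasureTheory
open scoped ENNReal

/-! ### Existence of regular graphs of large girth -/

/-- The words of length at most `N` over the alphabet `α` without two equal consecutive letters,
that is, the ball of radius `N` in the regular tree whose edges are coloured by `α`. -/
abbrev ReducedWord (α : Type*) (N : ℕ) : Type _ :=
  {l : List α // l.IsChain (· ≠ ·) ∧ l.length ≤ N}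

namespace ReducedWord

variable {α : Type*} {N : ℕ}

instance [Finite α] : Finite (ReducedWord α N) :=
  Set.Finite.subset (List.finite_length_le α N) fun _ hl => hl.2

theorem chain_cons {a : α} {l : List α} (hl : l.IsChain (· ≠ ·)) (ha : l.head? ≠ some a) :
    (a :: l).IsChain (· ≠ ·) := by
  cases l with
  | nil => simp
  | cons b l =>
    rw [List.isChain_cons_cons]
    exact ⟨fun h => ha (by simp [h]), hl⟩

/-- The empty word. -/
def nil : ReducedWord α N := ⟨[], by simp⟩

open Classical in
/-- Follow the edge of colour `a`, if it stays inside the ball. -/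
noncomputable def step (a : α) (l : ReducedWord α N) : ReducedWord α N :=
  if h : l.1.head? = some a then ⟨l.1.tail, l.2.1.tail, by have := l.2.2; simp; omega⟩
  else if hN : l.1.length < N then ⟨a :: l.1, chain_cons l.2.1 h, by simpa using hN⟩
  else l

theorem step_of_head {a : α} {l : ReducedWord α N} (h : l.1.head? = some a) :
    (step a l).1 = l.1.tail := by
  simp [step, h]

theorem step_of_ne_head {a : α} {l : ReducedWord α N} (h : l.1.head? ≠ some a)
    (hN : l.1.length < N) : (step a l).1 = a :: l.1 := by
  simp [step, h, hN]

theorem step_of_length {a : α} {l : ReducedWord α N} (h : l.1.head? ≠ some a)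
    (hN : ¬ l.1.length < N) : step a l = l := by
  simp [step, h, hN]

theorem step_involutive (a : α) : Function.Involutive (step (N := N) a) := by
  intro l
  by_cases h : l.1.head? = some a
  · have h1 := step_of_head h
    obtain ⟨l, hl, hN⟩ := l
    cases l with
    | nil => simp at h
    | cons b l =>
      obtain rfl : b = a := by simpa using h
      simp only [List.tail_cons] at h1
      have h2 : (step b ⟨b :: l, hl, hN⟩).1.head? ≠ some b := by
        rw [h1]
        intro h3
        cases l with
        | nil => simp at h3
        | cons c l =>
          rw [List.isChain_cons_cons] at hl
          exact hl.1 (by simpa using h3.symm)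
      apply Subtype.ext
      rw [step_of_ne_head h2 (by rw [h1]; simpa using hN), h1]
  · by_cases hN : l.1.length < N
    · have h1 := step_of_ne_head h hN
      apply Subtype.ext
      rw [step_of_head (by rw [h1]; simp), h1, List.tail_cons]
    · rw [step_of_length h hN, step_of_length h hN]

/-- `ReducedWord.step` as a permutation. -/
noncomputable def stepPerm (N : ℕ) (a : α) : Equiv.Perm (ReducedWord α N) :=
  (step_involutive a).toPerm

theorem stepPerm_apply (a : α) (l : ReducedWord α N) : stepPerm N a l = step a l := rfl

theorem stepPerm_mul_self (a : α) : stepPerm N a * stepPerm N a = 1 := by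
  ext1 l
  exact step_involutive a l

theorem stepPerm_nil (hN : 0 < N) (a : α) : (stepPerm N a nil).1 = [a] := by
  rw [stepPerm_apply, step_of_ne_head] <;> simp [nil, hN]

theorem stepPerm_injective (hN : 0 < N) : Function.Injective (stepPerm (α := α) N) := by
  intro a b h
  have h1 := stepPerm_nil hN a
  rw [h, stepPerm_nil hN b] at h1
  simpa using h1.symm

theorem stepPerm_ne_one (hN : 0 < N) (a : α) : stepPerm N a ≠ 1 := by
  intro h
  have h1 := stepPerm_nil hN a
  rw [h] at h1
  simp [nil] at h1

/-- The Cayley graph of the permutation group of the ball with respect to the steps. -/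
noncomputable def cayleyGraph (α : Type*) (N : ℕ) (hN : 0 < N) :
    SimpleGraph (Equiv.Perm (ReducedWord α N)) where
  Adj p q := ∃ a, p = stepPerm N a * q
  symm := ⟨by
    rintro p q ⟨a, rfl⟩
    exact ⟨a, by rw [← mul_assoc, stepPerm_mul_self, one_mul]⟩⟩
  loopless := ⟨by
    rintro p ⟨a, h⟩
    exact stepPerm_ne_one hN a (by simpa using h.symm)⟩

open Classical in
theorem cayleyGraph_isRegularOfDegree [Fintype α] (hN : 0 < N)
    [Fintype (Equiv.Perm (ReducedWord α N))] :
    (cayleyGraph α N hN).IsRegularOfDegree (Fintype.card α) := by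
  intro p
  rw [← SimpleGraph.card_neighborFinset_eq_degree, ← Finset.card_univ]
  symm
  refine Finset.card_bij (fun a _ => stepPerm N a * p) ?_ ?_ ?_
  · intro a _
    rw [SimpleGraph.mem_neighborFinset]
    exact SimpleGraph.Adj.symm (G := cayleyGraph α N hN) ⟨a, rfl⟩
  · intro a _ b _ h
    exact stepPerm_injective hN (by simpa using h)
  · intro q hq
    rw [SimpleGraph.mem_neighborFinset] at hq
    obtain ⟨a, h⟩ := hq.symm
    exact ⟨a, Finset.mem_univ _, h.symm⟩

/-- Traced from `q` back to `p`, every edge pushes its colour onto the word. It could only pop one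
if it undid the previous edge, and the second conjunct, carried along for the induction, says that
this would revisit a vertex. The length bound keeps the word off the boundary of the ball. -/
theorem length_apply_nil_of_isPath (hN : 0 < N) {p q : Equiv.Perm (ReducedWord α N)}
    (w : (cayleyGraph α N hN).Walk p q) (hw : w.IsPath) (hlen : w.length ≤ N) :
    ((p * q⁻¹) nil).1.length = w.length ∧
      ∀ a, ((p * q⁻¹) nil).1.head? = some a → stepPerm N a * p ∈ w.support := by
  induction w with
  | nil => simp [nil]
  | @cons p p' q h w ih =>
    rw [SimpleGraph.Walk.cons_isPath_iff] at hw
    rw [SimpleGraph.Walk.length_cons] at hlen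
    obtain ⟨ih1, ih2⟩ := ih hw.1 (by omega)
    obtain ⟨a, ha⟩ := id h
    have h1 : ((p' * q⁻¹) nil).1.head? ≠ some a := fun h2 => hw.2 (ha ▸ ih2 a h2)
    have h2 : ((p * q⁻¹) nil).1 = a :: ((p' * q⁻¹) nil).1 := by
      rw [ha, mul_assoc, Equiv.Perm.mul_apply, stepPerm_apply,
        step_of_ne_head h1 (by rw [ih1]; omega)]
    rw [h2, SimpleGraph.Walk.support_cons, SimpleGraph.Walk.length_cons, List.length_cons, ih1]
    refine ⟨rfl, ?_⟩
    intro b hb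
    obtain rfl : a = b := by simpa using hb
    rw [ha, ← mul_assoc, stepPerm_mul_self, one_mul]
    exact List.mem_cons_of_mem _ w.start_mem_support

theorem le_egirth_cayleyGraph (hN : 0 < N) : (N : ℕ∞) ≤ (cayleyGraph α N hN).egirth := by
  rw [SimpleGraph.le_egirth]
  intro p w hw
  by_contra hlt
  have hlt : w.length < N := by simpa using hlt
  have h3 := hw.three_le_length
  cases w with
  | nil => simp at h3
  | @cons _ q _ h w =>
    rw [SimpleGraph.Walk.cons_isCycle_iff] at hw
    rw [SimpleGraph.Walk.length_cons] at h3 hlt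
    -- The first edge of the cycle and the remaining path join the same two vertices: the edge gives
    -- a word of length 1, the path one of length at least 2.
    have h4 := (length_apply_nil_of_isPath hN w hw.1 (by omega)).1
    obtain ⟨a, rfl⟩ := h.symm
    rw [mul_assoc, mul_inv_cancel, mul_one, stepPerm_nil hN] at h4
    simp at h4
    omega

end ReducedWord

/-- For all `g` and `r` there is a finite nonempty `r`-regular graph of girth at least `g`. -/
instance RegularGirthGraph.nonempty (g r : ℕ) : Nonempty (RegularGirthGraph.{u} g r) := by
  classical
  have : Fintype (Equiv.Perm (ReducedWord (ULift.{u} (Fin r)) (g + 1))) := Fintype.ofFinite _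
  -- The radius `g + 1` is positive even for `g = 0`; `ULift` places the vertices in the required
  -- universe.
  refine ⟨{ V := Equiv.Perm (ReducedWord (ULift.{u} (Fin r)) (g + 1))
            graph := ReducedWord.cayleyGraph _ _ g.succ_pos
            regular := ?_
            le_girth := ?_ }⟩
  · have h := ReducedWord.cayleyGraph_isRegularOfDegree (α := ULift.{u} (Fin r)) g.succ_pos
    simp only [Fintype.card_ulift, Fintype.card_fin] at h
    convert h
  · exact le_trans (by simp) (ReducedWord.le_egirth_cayleyGraph g.succ_pos)

/-! ### The greedy algorithm seen from a single vertex -/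

theorem survivingEdges_subset {V : Type*} (E : Finset (Sym2 V)) (e : Sym2 V) :
    survivingEdges E e ⊆ E := by
  classical
  unfold survivingEdges
  exact Finset.filter_subset _ _

theorem mem_survivingEdges {V : Type*} {E : Finset (Sym2 V)} {e f : Sym2 V} :
    f ∈ survivingEdges E e ↔ f ∈ E ∧ ∀ v, v ∈ f → v ∉ e := by
  unfold survivingEdges
  simp

theorem notMem_survivingEdges_self {V : Type*} (E : Finset (Sym2 V)) (e : Sym2 V) :
    e ∉ survivingEdges E e := by
  intro h
  obtain ⟨a, b⟩ := e
  exact (mem_survivingEdges.1 h).2 a (Sym2.mem_mk_left a b) (Sym2.mem_mk_left a b)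

theorem toOuterMeasure_apply_le_one {α : Type*} (p : PMF α) (s : Set α) :
    p.toOuterMeasure s ≤ 1 :=
  (MeasureTheory.measure_mono (Set.subset_univ s)).trans
    ((PMF.toOuterMeasure_apply_eq_one_iff p Set.univ).2 (Set.subset_univ _)).le

/-- The probability that the greedy algorithm run on the set of edges `E` leaves `v` unmatched. -/
noncomputable def unmatchedProb {V : Type*} (E : Finset (Sym2 V)) (v : V) : ℝ :=
  ((greedyMatchingFrom E).toOuterMeasure {M | ∀ e ∈ M, v ∉ e}).toReal

theorem unmatchedProb_empty {V : Type*} (v : V) : unmatchedProb ∅ v = 1 := by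
  classical
  rw [unmatchedProb, greedyMatchingFrom]
  simp [PMF.toOuterMeasure_pure_apply]

/-- Condition on the first edge selected. This recursion is all that the comparison with arrival
times uses about the algorithm. -/
theorem unmatchedProb_eq_sum {V : Type*} {E : Finset (Sym2 V)} (hE : E.Nonempty) (v : V)
    [DecidablePred (v ∈ · : Sym2 V → Prop)] :
    unmatchedProb E v =
      (E.card : ℝ)⁻¹ * ∑ e ∈ E, if v ∈ e then 0 else unmatchedProb (survivingEdges E e) v := by
  classical
  have h1 : ∀ e, ((greedyMatchingFrom (survivingEdges E e)).map (insert e)).toOuterMeasure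
      {M | ∀ e ∈ M, v ∉ e} = if v ∈ e then 0 else
        (greedyMatchingFrom (survivingEdges E e)).toOuterMeasure {M | ∀ e ∈ M, v ∉ e} := by
    intro e
    rw [PMF.toOuterMeasure_map_apply]
    split_ifs with hv
    · have h : insert e ⁻¹' {M : Finset (Sym2 V) | ∀ e ∈ M, v ∉ e} = ∅ := by
        ext M
        simp [hv]
      rw [h, MeasureTheory.measure_empty]
    · congr 1
      ext M
      simp [hv]
  rw [unmatchedProb, greedyMatchingFrom, dif_pos hE, PMF.toOuterMeasure_bindOnSupport_apply,
    tsum_eq_sum (s := E)]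
  · have h2 : ∀ e ∈ E, ((PMF.uniformOfFinset E hE) e * if h : (PMF.uniformOfFinset E hE) e = 0
        then 0 else ((greedyMatchingFrom (survivingEdges E e)).map (insert e)).toOuterMeasure
          {M | ∀ e ∈ M, v ∉ e}) = (E.card : ℝ≥0∞)⁻¹ * if v ∈ e then 0 else
        (greedyMatchingFrom (survivingEdges E e)).toOuterMeasure {M | ∀ e ∈ M, v ∉ e} := by
      intro e he
      rw [PMF.uniformOfFinset_apply_of_mem _ he, h1, dif_neg (by simp)]
    rw [Finset.sum_congr rfl h2, ENNReal.toReal_sum, Finset.mul_sum]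
    · refine Finset.sum_congr rfl fun e _ => ?_
      rw [ENNReal.toReal_mul, ENNReal.toReal_inv, ENNReal.toReal_natCast]
      congr 1
      split_ifs <;> simp [unmatchedProb]
    · intro e _
      refine ENNReal.mul_ne_top (by simpa using hE.ne_empty) ?_
      split_ifs
      · simp
      · exact ne_top_of_le_ne_top ENNReal.one_ne_top (toOuterMeasure_apply_le_one _ _)
  · intro e he
    exact mul_eq_zero_of_left (PMF.uniformOfFinset_apply_of_notMem _ he) _

open Classical in
/-- The outcome of the greedy algorithm is a matching. -/
theorem subset_and_card_of_mem_support {V : Type*} [Fintype V]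
    (E : Finset (Sym2 V)) (hE : ∀ e ∈ E, ¬ e.IsDiag) (M : Finset (Sym2 V))
    (hM : M ∈ (greedyMatchingFrom E).support) :
    M ⊆ E ∧ (Finset.univ.filter fun v => ¬ ∀ e ∈ M, v ∉ e).card = 2 * M.card := by
  induction h : E.card using Nat.strong_induction_on generalizing E M with
  | _ n ih =>
    rw [greedyMatchingFrom] at hM
    split_ifs at hM with hne
    · rw [PMF.mem_support_bindOnSupport_iff] at hM
      obtain ⟨e, he, hM⟩ := hM
      have heE : e ∈ E := by
        by_contra h0
        exact he (PMF.uniformOfFinset_apply_of_notMem hne h0)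
      rw [PMF.mem_support_map_iff] at hM
      obtain ⟨M', hM', rfl⟩ := hM
      obtain ⟨h1, h2⟩ := ih _ (h ▸ card_survivingEdges_lt heE) (survivingEdges E e)
        (fun f hf => hE f (survivingEdges_subset E e hf)) M' hM' rfl
      refine ⟨Finset.insert_subset heE (h1.trans (survivingEdges_subset E e)), ?_⟩
      rw [Finset.card_insert_of_notMem fun h0 => notMem_survivingEdges_self E e (h1 h0),
        mul_add, ← h2]
      have h3 : (Finset.univ.filter fun v => ¬ ∀ f ∈ insert e M', v ∉ f) =
          (Finset.univ.filter fun v => ¬ ∀ f ∈ M', v ∉ f) ∪ e.toFinset := by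
        ext v
        simp only [Finset.mem_filter, Finset.mem_univ, true_and, Finset.mem_union,
          Sym2.mem_toFinset, Finset.forall_mem_insert]
        tauto
      rw [h3, Finset.card_union_of_disjoint, Sym2.card_toFinset_of_not_isDiag _ (hE e heE)]
      rw [Finset.disjoint_left]
      intro v hv hv'
      simp only [Finset.mem_filter, Finset.mem_univ, true_and, not_forall, not_not] at hv
      obtain ⟨f, hf, hvf⟩ := hv
      exact (mem_survivingEdges.1 (h1 hf)).2 v hvf (Sym2.mem_toFinset.1 hv')
    · rw [PMF.support_pure] at hM
      obtain rfl : M = ∅ := hM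
      simp

theorem unmatchedProb_eq_sum_ite {V : Type*} [Fintype V] (E : Finset (Sym2 V)) (v : V)
    [DecidablePred fun M : Finset (Sym2 V) => ∀ e ∈ M, v ∉ e] :
    unmatchedProb E v =
      ∑ M : Finset (Sym2 V), (greedyMatchingFrom E M).toReal * if ∀ e ∈ M, v ∉ e then 1 else 0 := by
  classical
  rw [unmatchedProb, PMF.toOuterMeasure_apply_fintype, ENNReal.toReal_sum]
  · refine Finset.sum_congr rfl fun M _ => ?_
    simp only [Set.indicator, Set.mem_ofPred_eq]
    split_ifs <;> simp
  · intro M _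
    refine ne_top_of_le_ne_top ENNReal.one_ne_top ?_
    exact (Set.indicator_le_self _ _ _).trans (PMF.coe_le_one _ _)

-- Linearity of expectation: the outcome is a matching, so its size is half the number of covered
-- vertices.
open Classical in
theorem expectedGreedyMatchingRatio_eq {V : Type*} [Fintype V] [Nonempty V] (G : SimpleGraph V) :
    expectedGreedyMatchingRatio G =
      (∑ v : V, (1 - unmatchedProb G.edgeFinset v) / 2) / Fintype.card V := by
  have hsum : ∑ M : Finset (Sym2 V), (greedyMatchingFrom G.edgeFinset M).toReal = 1 := by
    rw [← ENNReal.toReal_sum fun M _ => PMF.apply_ne_top _ _, ← tsum_fintype (L := .unconditional _),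
      PMF.tsum_coe, ENNReal.toReal_one]
  have h1 : ∀ v : V, (1 - unmatchedProb G.edgeFinset v) / 2 = ∑ M : Finset (Sym2 V),
      (greedyMatchingFrom G.edgeFinset M).toReal * (if ¬ ∀ e ∈ M, v ∉ e then 1 else 0) / 2 := by
    intro v
    rw [← Finset.sum_div]
    congr 1
    rw [sub_eq_iff_eq_add, unmatchedProb_eq_sum_ite, ← Finset.sum_add_distrib]
    refine hsum.symm.trans (Finset.sum_congr rfl fun M _ => ?_)
    by_cases hv : ∀ e ∈ M, v ∉ e
    · rw [if_pos hv, if_neg (not_not.2 hv)]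
      ring
    · rw [if_neg hv, if_pos hv]
      ring
  simp only [h1]
  rw [Finset.sum_comm, Finset.sum_div, expectedGreedyMatchingRatio]
  refine Finset.sum_congr rfl fun M _ => ?_
  have h0 : greedyMatching G = greedyMatchingFrom G.edgeFinset := rfl
  rw [h0]
  by_cases hM : greedyMatchingFrom G.edgeFinset M = 0
  · simp [hM]
  · have h2 := (subset_and_card_of_mem_support G.edgeFinset
      (fun e he => G.not_isDiag_of_mem_edgeSet (SimpleGraph.mem_edgeFinset.1 he)) M hM).2
    rw [← Finset.sum_div, ← Finset.mul_sum, Finset.sum_boole, h2]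
    push_cast
    ring

/-! ### Independent uniform weights -/

/-- Lebesgue measure on the unit interval. -/
noncomputable def unitMeasure : Measure ℝ := volume.restrict (Set.Ioc 0 1)

instance : IsProbabilityMeasure unitMeasure := ⟨by simp [unitMeasure]⟩

instance : NullSingletonClass unitMeasure := by unfold unitMeasure; infer_instance

/-- The law of a family of independent uniform weights in the unit interval. -/
noncomputable def weightMeasure (ι : Type*) [Fintype ι] : Measure (ι → ℝ) :=
  Measure.pi fun _ => unitMeasure

section

variable {ι : Type*} [Fintype ι]

instance : IsProbabilityMeasure (weightMeasure ι) := by unfold weightMeasure; infer_instance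

/-- Splicing two independent copies along `S` preserves the law, and turns an intersection of events
living on `S` and on its complement into a product set. -/
theorem measurePreserving_piecewise (S : Finset ι) [DecidableEq ι] :
    MeasurePreserving (fun p : (ι → ℝ) × (ι → ℝ) => S.piecewise p.1 p.2)
      ((weightMeasure ι).prod (weightMeasure ι)) (weightMeasure ι) := by
  have hm : Measurable (fun p : (ι → ℝ) × (ι → ℝ) => S.piecewise p.1 p.2) := by
    rw [measurable_pi_iff]
    intro i
    by_cases hi : i ∈ S
    · simp only [Finset.piecewise_eq_of_mem _ _ _ hi]
      exact (measurable_pi_apply i).comp measurable_fst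
    · simp only [Finset.piecewise_eq_of_notMem _ _ _ hi]
      exact (measurable_pi_apply i).comp measurable_snd
  refine ⟨hm, ?_⟩
  symm
  refine Measure.pi_eq fun s hs => ?_
  rw [Measure.map_apply hm (MeasurableSet.univ_pi hs)]
  have h : (fun p : (ι → ℝ) × (ι → ℝ) => S.piecewise p.1 p.2) ⁻¹' Set.univ.pi s =
      (Set.univ.pi fun i => if i ∈ S then s i else Set.univ) ×ˢ
        (Set.univ.pi fun i => if i ∈ S then Set.univ else s i) := by
    ext p
    simp only [Set.mem_preimage, Set.mem_pi, Set.mem_univ, true_imp_iff, Set.mem_prod,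
      Finset.piecewise]
    rw [← forall_and]
    refine forall_congr' fun i => ?_
    split_ifs <;> simp
  rw [h, Measure.prod_prod, weightMeasure, Measure.pi_pi, Measure.pi_pi, ← Finset.prod_mul_distrib]
  refine Finset.prod_congr rfl fun i _ => ?_
  split_ifs <;> simp

/-- Events that depend on disjoint sets of weights are independent. -/
theorem weightMeasure_inter {S : Finset ι} {A B : Set (ι → ℝ)} (hA : MeasurableSet A)
    (hB : MeasurableSet B) (hAS : DependsOn (· ∈ A) (S : Set ι))
    (hBS : DependsOn (· ∈ B) (S : Set ι)ᶜ) :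
    weightMeasure ι (A ∩ B) = weightMeasure ι A * weightMeasure ι B := by
  classical
  rw [← (measurePreserving_piecewise S).measure_preimage (hA.inter hB).nullMeasurableSet,
    ← Measure.prod_prod]
  congr 1
  ext p
  have h1 : (S.piecewise p.1 p.2 ∈ A) = (p.1 ∈ A) :=
    hAS fun i hi => Finset.piecewise_eq_of_mem _ _ _ hi
  have h2 : (S.piecewise p.1 p.2 ∈ B) = (p.2 ∈ B) :=
    hBS fun i hi => Finset.piecewise_eq_of_notMem _ _ _ hi
  simp only [Set.mem_preimage, Set.mem_inter_iff, Set.mem_prod, h1, h2]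

/-- Finitely many events that depend on disjoint sets of weights are independent. -/
theorem weightMeasure_biInter {κ : Type*} (N : Finset κ) (T : κ → Finset ι)
    (A : κ → Set (ι → ℝ)) (hT : (N : Set κ).PairwiseDisjoint T)
    (hA : ∀ x ∈ N, MeasurableSet (A x))
    (hAT : ∀ x ∈ N, DependsOn (· ∈ A x) (T x : Set ι)) :
    weightMeasure ι {ω | ∀ x ∈ N, ω ∈ A x} = ∏ x ∈ N, weightMeasure ι (A x) := by
  classical
  induction N using Finset.induction_on with
  | empty => simp
  | insert y N hy ih =>
    have h : {ω | ∀ x ∈ insert y N, ω ∈ A x} = A y ∩ {ω | ∀ x ∈ N, ω ∈ A x} := by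
      ext ω
      simp
    rw [h, Finset.prod_insert hy, ← ih (hT.subset (by simp))
      (fun x hx => hA x (by simp [hx])) (fun x hx => hAT x (by simp [hx]))]
    refine weightMeasure_inter (S := T y) (hA y (by simp)) ?_ (hAT y (by simp)) ?_
    · have : {ω | ∀ x ∈ N, ω ∈ A x} = ⋂ x ∈ N, A x := by ext; simp
      rw [this]
      exact Finset.measurableSet_biInter _ fun x hx => hA x (by simp [hx])
    · intro ω ω' hω
      simp only [Set.mem_ofPred_eq, eq_iff_iff]
      refine forall₂_congr fun x hx => ?_
      have hd : Disjoint (T y) (T x) :=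
        hT (by simp) (by simp [hx]) (by rintro rfl; exact hy hx)
      exact iff_of_eq (hAT x (by simp [hx]) fun i hi =>
        hω i fun hi' => Finset.disjoint_left.1 hd hi' hi)

/-- Resampling one coordinate preserves the law, so that coordinate can be integrated separately. -/
theorem measurePreserving_update [DecidableEq ι] (e : ι) :
    MeasurePreserving (fun p : ℝ × (ι → ℝ) => Function.update p.2 e p.1)
      (unitMeasure.prod (weightMeasure ι)) (weightMeasure ι) := by
  have hm : Measurable (fun p : ℝ × (ι → ℝ) => Function.update p.2 e p.1) := by
    rw [measurable_pi_iff]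
    intro i
    by_cases hi : i = e
    · subst hi
      simp only [Function.update_self]
      exact measurable_fst
    · simp only [Function.update_of_ne hi]
      exact (measurable_pi_apply i).comp measurable_snd
  refine ⟨hm, ?_⟩
  symm
  refine Measure.pi_eq fun s hs => ?_
  rw [Measure.map_apply hm (MeasurableSet.univ_pi hs)]
  have h : (fun p : ℝ × (ι → ℝ) => Function.update p.2 e p.1) ⁻¹' Set.univ.pi s =
      s e ×ˢ (Set.univ.pi fun i => if i = e then Set.univ else s i) := by
    ext p
    simp only [Set.mem_preimage, Set.mem_pi, Set.mem_univ, true_imp_iff, Set.mem_prod]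
    constructor
    · intro h
      refine ⟨by simpa using h e, fun i => ?_⟩
      split_ifs with hi
      · simp
      · simpa [hi] using h i
    · rintro ⟨h1, h2⟩ i
      by_cases hi : i = e
      · subst hi
        simpa using h1
      · simpa [hi] using h2 i
  rw [h, Measure.prod_prod, weightMeasure, Measure.pi_pi,
    ← Finset.mul_prod_erase Finset.univ _ (Finset.mem_univ e),
    ← Finset.mul_prod_erase Finset.univ (fun i => unitMeasure (s i)) (Finset.mem_univ e)]
  simp only [if_true, measure_univ, one_mul]
  congr 1
  refine Finset.prod_congr rfl fun i hi => ?_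
  rw [if_neg (Finset.ne_of_mem_erase hi)]

/-- Fubini's theorem for a single weight. -/
theorem weightMeasure_eq_lintegral (e : ι) {B : Set (ℝ × (ι → ℝ))} (hB : MeasurableSet B)
    (hBe : ∀ s, DependsOn (fun ω => (s, ω) ∈ B) {e}ᶜ) :
    weightMeasure ι {ω | (ω e, ω) ∈ B} = ∫⁻ s, weightMeasure ι {ω | (s, ω) ∈ B} ∂unitMeasure := by
  classical
  have hm : Measurable fun ω : ι → ℝ => (ω e, ω) := (measurable_pi_apply e).prodMk measurable_id
  have h1 := (measurePreserving_update e).measure_preimage (hm hB).nullMeasurableSet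
  change _ = weightMeasure ι {ω | (ω e, ω) ∈ B} at h1
  rw [← h1]
  have h2 : (fun p : ℝ × (ι → ℝ) => Function.update p.2 e p.1) ⁻¹'
      ((fun ω : ι → ℝ => (ω e, ω)) ⁻¹' B) = B := by
    ext p
    simp only [Set.mem_preimage, Function.update_self]
    exact iff_of_eq (hBe p.1 fun i hi => Function.update_of_ne (by simpa using hi) _ _)
  rw [h2, Measure.prod_apply hB]
  rfl

theorem weightMeasure_real_eq_integral (e : ι) {B : Set (ℝ × (ι → ℝ))} (hB : MeasurableSet B)
    (hBe : ∀ s, DependsOn (fun ω => (s, ω) ∈ B) {e}ᶜ) :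
    (weightMeasure ι).real {ω | (ω e, ω) ∈ B} =
      ∫ s in (0 : ℝ)..1, (weightMeasure ι).real {ω | (s, ω) ∈ B} := by
  rw [intervalIntegral.integral_of_le zero_le_one]
  change _ = ∫ s, (weightMeasure ι {ω | (s, ω) ∈ B}).toReal ∂unitMeasure
  have hmeas : Measurable fun s => weightMeasure ι {ω | (s, ω) ∈ B} :=
    measurable_measure_prodMk_left hB
  rw [integral_toReal hmeas.aemeasurable (Filter.Eventually.of_forall fun s => measure_lt_top _ _),
    measureReal_def, weightMeasure_eq_lintegral e hB hBe]

theorem weightMeasure_apply_eq_apply {e f : ι} (hef : e ≠ f) :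
    weightMeasure ι {ω | ω e = ω f} = 0 := by
  have h := weightMeasure_eq_lintegral e (B := {p | p.1 = p.2 f})
    (measurableSet_eq_fun measurable_fst ((measurable_pi_apply f).comp measurable_snd))
    (fun s ω ω' h => by simp [h f (by simpa using hef.symm)])
  refine h.trans ?_
  refine lintegral_eq_zero_of_ae_eq_zero (Filter.Eventually.of_forall fun s => ?_)
  change Measure.pi (fun _ : ι => unitMeasure) {ω | s = ω f} = 0
  have := Measure.pi_eval_preimage_null (fun _ : ι => unitMeasure) (i := f) (s := {s}) (by simp)
  convert this using 2
  ext ω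
  simp [eq_comm]

theorem weightMeasure_real_forall_lt (S : Finset ι) {s : ℝ} (hs : s ∈ Set.Icc (0 : ℝ) 1) :
    (weightMeasure ι).real {ω | ∀ f ∈ S, s < ω f} = (1 - s) ^ S.card := by
  classical
  have h : {ω : ι → ℝ | ∀ f ∈ S, s < ω f} =
      Set.univ.pi fun f => if f ∈ S then Set.Ioi s else Set.univ := by
    ext ω
    simp only [Set.mem_ofPred_eq, Set.mem_pi, Set.mem_univ, true_imp_iff]
    refine forall_congr' fun f => ?_
    split_ifs with hf <;> simp [hf]
  have h1 : unitMeasure (Set.Ioi s) = ENNReal.ofReal (1 - s) := by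
    rw [unitMeasure, Measure.restrict_apply measurableSet_Ioi]
    have : Set.Ioi s ∩ Set.Ioc 0 1 = Set.Ioc s 1 := by
      ext x
      simp only [Set.mem_inter_iff, Set.mem_Ioi, Set.mem_Ioc]
      constructor
      · rintro ⟨a, b, c⟩
        exact ⟨a, c⟩
      · rintro ⟨a, b⟩
        exact ⟨a, hs.1.trans_lt a, b⟩
    rw [this, Real.volume_Ioc]
  rw [h, measureReal_def, weightMeasure, Measure.pi_pi]
  have h2 : ∀ f, unitMeasure (if f ∈ S then Set.Ioi s else Set.univ) =
      if f ∈ S then ENNReal.ofReal (1 - s) else 1 := by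
    intro f
    split_ifs <;> simp [h1]
  simp only [h2]
  rw [Finset.prod_ite_mem, Finset.univ_inter, Finset.prod_const, ENNReal.toReal_pow,
    ENNReal.toReal_ofReal (by linarith [hs.2])]

end

/-! ### Greedy matching by arrival times -/

section

variable {V : Type*} {E : Finset (Sym2 V)} {ω ω' : Sym2 V → ℝ} {v w : V} {s t : ℝ} {e : Sym2 V}

/-- The recursion that decides whether `w` is unmatched before time `t` when the edges of `E`
arrive at the times `ω`, cut off at depth `n`. -/
def freeWithin (E : Finset (Sym2 V)) (ω : Sym2 V → ℝ) : ℕ → V → ℝ → Prop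
  | 0, _, _ => True
  | n + 1, w, t => ∀ x, s(w, x) ∈ E → ω s(w, x) < t → ¬ freeWithin E ω n x (ω s(w, x))

/-- The greedy algorithm that considers the edges of `E` in the order of their weights `ω` leaves
`w` unmatched before time `t`. -/
def GreedyFree (E : Finset (Sym2 V)) (ω : Sym2 V → ℝ) (w : V) (t : ℝ) : Prop :=
  freeWithin E ω E.card w t

theorem card_filter_lt_of_lt (he : e ∈ E) (ht : ω e < t) :
    (E.filter fun f => ω f < ω e).card < (E.filter fun f => ω f < t).card := by
  refine Finset.card_lt_card ?_
  rw [Finset.ssubset_iff_of_subset]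
  · exact ⟨e, by simp [he, ht]⟩
  · intro f hf
    rw [Finset.mem_filter] at hf ⊢
    exact ⟨hf.1, hf.2.trans ht⟩

/-- Weights strictly decrease along the recursion, so its depth is at most the number of edges
lighter than `t`, and further depth changes nothing. Hence the cutoff `E.card` is never felt. -/
theorem freeWithin_iff_succ (n : ℕ) (w : V) (t : ℝ) (hn : (E.filter fun f => ω f < t).card ≤ n) :
    freeWithin E ω n w t ↔ freeWithin E ω (n + 1) w t := by
  induction n generalizing w t with
  | zero =>
    simp only [freeWithin, true_iff, not_true_eq_false, imp_false]
    intro x hx ht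
    have := card_filter_lt_of_lt hx ht
    omega
  | succ n ih =>
    rw [freeWithin, freeWithin]
    refine forall_congr' fun x => forall₂_congr fun hx ht => not_congr (ih _ _ ?_)
    have := card_filter_lt_of_lt hx ht
    omega

theorem free_iff : GreedyFree E ω w t ↔
    ∀ x, s(w, x) ∈ E → ω s(w, x) < t → ¬ GreedyFree E ω x (ω s(w, x)) := by
  rw [GreedyFree, freeWithin_iff_succ _ _ _ (Finset.card_filter_le _ _), freeWithin]
  rfl

theorem freeWithin_congr (h : ∀ f ∈ E, ω f = ω' f) (n : ℕ) (w : V) (t : ℝ) :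
    freeWithin E ω n w t ↔ freeWithin E ω' n w t := by
  induction n generalizing w t with
  | zero => rfl
  | succ n ih =>
    rw [freeWithin, freeWithin]
    refine forall_congr' fun x => forall_congr' fun hx => ?_
    rw [h _ hx, ih]

theorem free_congr (h : ∀ f ∈ E, ω f = ω' f) : GreedyFree E ω w t ↔ GreedyFree E ω' w t :=
  freeWithin_congr h _ _ _

theorem free_of_forall_le (h : ∀ f ∈ E, t ≤ ω f) : GreedyFree E ω w t :=
  free_iff.2 fun _ hx ht => absurd ht (h _ hx).not_gt

/-- When the lightest edge arrives, its other end is free because nothing came earlier. -/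
theorem not_free_of_mem (he : e ∈ E) (hmin : ∀ f ∈ E, ω e ≤ ω f) (hv : v ∈ e) (ht : ω e < t) :
    ¬ GreedyFree E ω v t := by
  obtain ⟨x, rfl⟩ := hv
  intro h
  exact free_iff.1 h x he ht (free_of_forall_le hmin)

/-- An edge from `v` that is deleted leads to an endpoint of `e`, which is already taken when that
edge arrives. Its clause in the recursion therefore holds anyway and can be dropped. -/
theorem free_survivingEdges_iff (he : e ∈ E) (hmin : ∀ f ∈ E, f ≠ e → ω e < ω f) (n : ℕ)
    (v : V) (t : ℝ) (hn : (E.filter fun f => ω f < t).card ≤ n) (hv : v ∉ e) :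
    GreedyFree E ω v t ↔ GreedyFree (survivingEdges E e) ω v t := by
  have hmin' : ∀ f ∈ E, ω e ≤ ω f := by
    intro f hf
    by_cases hfe : f = e
    · rw [hfe]
    · exact (hmin f hf hfe).le
  induction n using Nat.strong_induction_on generalizing v t with
  | _ n ih =>
    rw [free_iff, free_iff (E := survivingEdges E e)]
    refine forall_congr' fun x => ?_
    by_cases hx : x ∈ e
    · have h1 : s(v, x) ∉ survivingEdges E e := fun h =>
        (mem_survivingEdges.1 h).2 x (Sym2.mem_mk_right _ _) hx
      simp only [h1, false_imp_iff, iff_true]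
      intro hxE _
      refine not_free_of_mem he hmin' hx (hmin _ hxE ?_)
      rintro rfl
      exact hv (Sym2.mem_mk_left _ _)
    · have h1 : s(v, x) ∈ survivingEdges E e ↔ s(v, x) ∈ E := by
        rw [mem_survivingEdges]
        refine and_iff_left fun y hy => ?_
        rcases Sym2.mem_iff.1 hy with rfl | rfl
        · exact hv
        · exact hx
      rw [h1]
      refine forall₂_congr fun hxE ht => not_congr ?_
      exact ih _ ((card_filter_lt_of_lt hxE ht).trans_le hn) x _ le_rfl hx

theorem measurable_freeWithin [Fintype V] (E : Finset (Sym2 V)) (n : ℕ) (w : V) :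
    Measurable fun p : ℝ × (Sym2 V → ℝ) => freeWithin E p.2 n w p.1 := by
  induction n generalizing w with
  | zero => exact measurable_const
  | succ n ih =>
    simp only [freeWithin]
    refine Measurable.forall fun x => measurable_const.imp ?_
    have h1 : Measurable fun p : ℝ × (Sym2 V → ℝ) => p.2 s(w, x) :=
      (measurable_pi_apply _).comp measurable_snd
    exact (measurableSet_setOfPred.1 (measurableSet_lt h1 measurable_fst)).imp
      ((ih x).comp (h1.prodMk measurable_snd)).not

theorem measurableSet_free [Fintype V] (E : Finset (Sym2 V)) (w : V) (t : ℝ) :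
    MeasurableSet {ω | GreedyFree E ω w t} :=
  measurableSet_setOfPred.2 ((measurable_freeWithin E E.card w).comp measurable_prodMk_left)

theorem integral_indicator_Ioo {a b : ℝ} (ha : 0 ≤ a) (hab : a ≤ b) (hb : b ≤ 1) (f : ℝ → ℝ) :
    ∫ τ in (0 : ℝ)..1, (Set.Ioo a b).indicator f τ = ∫ τ in a..b, f τ := by
  rw [intervalIntegral.integral_of_le zero_le_one, setIntegral_indicator measurableSet_Ioo,
    intervalIntegral.integral_of_le hab, integral_Ioc_eq_integral_Ioo]
  congr 2
  rw [Set.inter_eq_right]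
  exact fun x hx => ⟨ha.trans_lt hx.1, (hx.2.trans_le hb).le⟩

theorem integral_one_sub_pow (s : ℝ) (n : ℕ) :
    ∫ τ in s..1, (1 - τ) ^ n = (1 - s) ^ (n + 1) / (n + 1) := by
  rw [intervalIntegral.integral_comp_sub_left (fun x => x ^ n) (1 : ℝ), integral_pow]
  simp

theorem measurableSet_forall_lt [Fintype V] (D : Finset (Sym2 V)) (s : ℝ) :
    MeasurableSet {ω : Sym2 V → ℝ | ∀ f ∈ D, s < ω f} := by
  have : {ω : Sym2 V → ℝ | ∀ f ∈ D, s < ω f} = ⋂ f ∈ D, {ω | s < ω f} := by ext; simp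
  rw [this]
  exact Finset.measurableSet_biInter _ fun f _ =>
    measurableSet_lt measurable_const (measurable_pi_apply f)

theorem ae_exists_strict_min [Fintype V] (hE : E.Nonempty) :
    ∀ᵐ ω ∂weightMeasure (Sym2 V), ∃ e ∈ E, ω e < 1 ∧ ∀ f ∈ E, f ≠ e → ω e < ω f := by
  have h1 : ∀ᵐ ω ∂weightMeasure (Sym2 V), ∀ e f : Sym2 V, e ≠ f → ω e ≠ ω f := by
    rw [ae_all_iff]
    intro e
    rw [ae_all_iff]
    intro f
    by_cases hef : e = f
    · simp [hef]
    · have h := weightMeasure_apply_eq_apply hef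
      rw [measure_eq_zero_iff_ae_notMem] at h
      filter_upwards [h] with ω hω _ using hω
  have h2 : ∀ᵐ ω ∂weightMeasure (Sym2 V), ∀ e : Sym2 V, ω e < 1 := by
    rw [ae_all_iff]
    intro e
    have h := Measure.pi_eval_preimage_null (fun _ : Sym2 V => unitMeasure) (i := e)
      (s := Set.Ici 1) (by
        rw [unitMeasure, Measure.restrict_apply measurableSet_Ici]
        have : Set.Ici (1 : ℝ) ∩ Set.Ioc 0 1 ⊆ {1} := fun x hx =>
          le_antisymm hx.2.2 hx.1
        exact measure_mono_null this (by simp))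
    rw [measure_eq_zero_iff_ae_notMem] at h
    filter_upwards [h] with ω hω
    simpa using hω
  filter_upwards [h1, h2] with ω hω hω2
  obtain ⟨e, he, hmin⟩ := Finset.exists_min_image E ω hE
  exact ⟨e, he, hω2 e, fun f hf hfe => lt_of_le_of_ne (hmin f hf) (hω _ _ hfe.symm)⟩

/-- Split by the lightest edge `e` and its weight τ. The other deleted edges exceed τ with
probability (1 - τ)^|D|, and the survivors are handled by induction; this is why the statement
carries the threshold `s`. Integrating (1 - τ)^(n-1) over (s, 1) gives (1 - s)^n / n, and 1/n is the
uniform choice of the first edge. -/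
theorem weightMeasure_real_free [Fintype V] (E : Finset (Sym2 V)) (v : V) {s : ℝ}
    (hs : s ∈ Set.Icc (0 : ℝ) 1) :
    (weightMeasure (Sym2 V)).real {ω | GreedyFree E ω v 1 ∧ ∀ f ∈ E, s < ω f} =
      (1 - s) ^ E.card * unmatchedProb E v := by
  classical
  induction h : E.card using Nat.strong_induction_on generalizing E s with
  | _ n ih =>
  rcases E.eq_empty_or_nonempty with rfl | hE
  · obtain rfl : 0 = n := h
    have : {ω : Sym2 V → ℝ | GreedyFree ∅ ω v 1 ∧ ∀ f ∈ (∅ : Finset (Sym2 V)), s < ω f} = Set.univ :=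
      Set.eq_univ_of_forall fun ω => ⟨free_of_forall_le (by simp), by simp⟩
    rw [this, unmatchedProb_empty]
    simp
  set B : Sym2 V → Set (Sym2 V → ℝ) := fun e =>
    {ω | ω e ∈ Set.Ioo s 1 ∧ (∀ f ∈ E, f ≠ e → ω e < ω f) ∧ GreedyFree E ω v 1} with hB
  have hBmeas : ∀ e, MeasurableSet (B e) := by
    intro e
    have h1 : MeasurableSet {ω : Sym2 V → ℝ | ∀ f ∈ E, f ≠ e → ω e < ω f} := by
      have : {ω : Sym2 V → ℝ | ∀ f ∈ E, f ≠ e → ω e < ω f} =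
          ⋂ f ∈ E.erase e, {ω | ω e < ω f} := by
        ext
        simp only [Set.mem_ofPred_eq, Finset.mem_erase, Set.mem_iInter]
        tauto
      rw [this]
      exact Finset.measurableSet_biInter _ fun f _ =>
        measurableSet_lt (measurable_pi_apply e) (measurable_pi_apply f)
    exact ((measurable_pi_apply e) measurableSet_Ioo).inter (h1.inter (measurableSet_free E v 1))
  have hdisj : (E : Set (Sym2 V)).PairwiseDisjoint B := by
    intro e he f hf hef
    refine Set.disjoint_left.2 fun ω h1 h2 => ?_
    exact lt_asymm (h1.2.1 f hf hef.symm) (h2.2.1 e he hef)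
  have hA : {ω | GreedyFree E ω v 1 ∧ ∀ f ∈ E, s < ω f} =ᵐ[weightMeasure (Sym2 V)] ⋃ e ∈ E, B e := by
    filter_upwards [ae_exists_strict_min hE] with ω hω
    refine propext ?_
    change (GreedyFree E ω v 1 ∧ ∀ f ∈ E, s < ω f) ↔ ω ∈ ⋃ e ∈ E, B e
    simp only [Set.mem_iUnion, exists_prop]
    constructor
    · rintro ⟨h1, h2⟩
      obtain ⟨e, he, he1, hmin⟩ := hω
      exact ⟨e, he, ⟨h2 e he, he1⟩, hmin, h1⟩
    · rintro ⟨e, he, ⟨h1, h2⟩, h3, h4⟩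
      refine ⟨h4, fun f hf => ?_⟩
      by_cases hfe : f = e
      · rwa [hfe]
      · exact h1.trans (h3 f hf hfe)
  have hBe : ∀ e ∈ E, (weightMeasure (Sym2 V)).real (B e) =
      (1 - s) ^ n * ((E.card : ℝ)⁻¹ *
        if v ∈ e then 0 else unmatchedProb (survivingEdges E e) v) := by
    intro e he
    by_cases hv : v ∈ e
    · have : B e = ∅ := by
        refine Set.eq_empty_of_forall_notMem fun ω hω => ?_
        refine not_free_of_mem he (fun f hf => ?_) hv hω.1.2 hω.2.2
        by_cases hfe : f = e
        · rw [hfe]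
        · exact (hω.2.1 f hf hfe).le
      simp [this, hv]
    · set S := survivingEdges E e with hS
      -- The edges other than `e` that the selection of `e` deletes.
      set D := (E.erase e) \ S with hD
      have heS : e ∉ S := notMem_survivingEdges_self E e
      have hSE : S ⊆ E.erase e := fun f hf =>
        Finset.mem_erase.2 ⟨fun h => heS (h ▸ hf), survivingEdges_subset E e hf⟩
      have hcard : D.card + S.card = E.card - 1 := by
        rw [hD, Finset.card_sdiff_add_card_eq_card hSE, Finset.card_erase_of_mem he]
      have hpos : 0 < E.card := hE.card_pos
      have hunion : ∀ f, f ∈ E ∧ f ≠ e ↔ f ∈ D ∨ f ∈ S := by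
        intro f
        rw [hD, Finset.mem_sdiff, Finset.mem_erase]
        constructor
        · rintro ⟨h1, h2⟩
          by_cases h3 : f ∈ S
          · exact Or.inr h3
          · exact Or.inl ⟨⟨h2, h1⟩, h3⟩
        · rintro (h | h)
          · exact ⟨h.1.2, h.1.1⟩
          · exact (Finset.mem_erase.1 (hSE h)).symm
      have heD : e ∉ D := by simp [hD]
      have h1 : B e = {ω | (ω e, ω) ∈ {p : ℝ × (Sym2 V → ℝ) | p.1 ∈ Set.Ioo s 1 ∧
          (∀ f ∈ D, p.1 < p.2 f) ∧ GreedyFree S p.2 v 1 ∧ ∀ f ∈ S, p.1 < p.2 f}} := by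
        ext ω
        change (_ ∧ _ ∧ _) ↔ (_ ∧ _ ∧ _ ∧ _)
        refine and_congr_right fun _ => ?_
        constructor
        · rintro ⟨h2, h3⟩
          refine ⟨fun f hf => ?_, ?_, fun f hf => ?_⟩
          · obtain ⟨h4, h5⟩ := (hunion f).2 (Or.inl hf)
            exact h2 f h4 h5
          · exact (free_survivingEdges_iff he h2 _ v 1 le_rfl hv).1 h3
          · obtain ⟨h4, h5⟩ := (hunion f).2 (Or.inr hf)
            exact h2 f h4 h5
        · rintro ⟨h2, h3, h4⟩
          have h5 : ∀ f ∈ E, f ≠ e → ω e < ω f := by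
            intro f hf hfe
            rcases (hunion f).1 ⟨hf, hfe⟩ with h | h
            · exact h2 f h
            · exact h4 f h
          exact ⟨h5, (free_survivingEdges_iff he h5 _ v 1 le_rfl hv).2 h3⟩
      rw [h1, weightMeasure_real_eq_integral]
      · have h2 : ∀ τ, (weightMeasure (Sym2 V)).real {ω | (τ, ω) ∈
            {p : ℝ × (Sym2 V → ℝ) | p.1 ∈ Set.Ioo s 1 ∧
            (∀ f ∈ D, p.1 < p.2 f) ∧ GreedyFree S p.2 v 1 ∧ ∀ f ∈ S, p.1 < p.2 f}} =
            (Set.Ioo s 1).indicator (fun τ => (1 - τ) ^ (n - 1) * unmatchedProb S v) τ := by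
          intro τ
          by_cases hτ : τ ∈ Set.Ioo s 1
          · rw [Set.indicator_of_mem hτ]
            have hτ' : τ ∈ Set.Icc (0 : ℝ) 1 := ⟨hs.1.trans hτ.1.le, hτ.2.le⟩
            have h3 : {ω | (τ, ω) ∈ {p : ℝ × (Sym2 V → ℝ) | p.1 ∈ Set.Ioo s 1 ∧
                (∀ f ∈ D, p.1 < p.2 f) ∧ GreedyFree S p.2 v 1 ∧ ∀ f ∈ S, p.1 < p.2 f}} =
                {ω | ∀ f ∈ D, τ < ω f} ∩ {ω | GreedyFree S ω v 1 ∧ ∀ f ∈ S, τ < ω f} := by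
              ext ω
              exact and_iff_right hτ
            have hmeas : MeasurableSet {ω | GreedyFree S ω v 1 ∧ ∀ f ∈ S, τ < ω f} :=
              (measurableSet_free S v 1).inter (measurableSet_forall_lt S τ)
            rw [h3, measureReal_def,
              weightMeasure_inter (S := D) (measurableSet_forall_lt D τ) hmeas,
              ENNReal.toReal_mul, ← measureReal_def, ← measureReal_def,
              weightMeasure_real_forall_lt D hτ',
              ih S.card (by omega) S hτ' rfl, ← mul_assoc, ← pow_add, hcard, h]
            · intro ω ω' hω
              simp only [Set.mem_ofPred_eq, eq_iff_iff]
              refine forall₂_congr fun f hf => ?_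
              rw [hω f hf]
            · intro ω ω' hω
              have h4 : ∀ f ∈ S, ω f = ω' f := fun f hf =>
                hω f fun hf' => (Finset.mem_sdiff.1 hf').2 hf
              simp only [Set.mem_ofPred_eq, eq_iff_iff]
              refine and_congr (free_congr h4) (forall₂_congr fun f hf => ?_)
              rw [h4 f hf]
          · rw [Set.indicator_of_notMem hτ]
            have h3 : {ω | (τ, ω) ∈ {p : ℝ × (Sym2 V → ℝ) | p.1 ∈ Set.Ioo s 1 ∧
                (∀ f ∈ D, p.1 < p.2 f) ∧ GreedyFree S p.2 v 1 ∧ ∀ f ∈ S, p.1 < p.2 f}} = ∅ :=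
              Set.eq_empty_of_forall_notMem fun ω hω => hτ hω.1
            rw [h3, measureReal_empty]
        simp only [h2]
        rw [integral_indicator_Ioo hs.1 hs.2 le_rfl, intervalIntegral.integral_mul_const,
          integral_one_sub_pow, if_neg hv]
        obtain ⟨m, rfl⟩ : ∃ m, n = m + 1 := ⟨n - 1, by omega⟩
        rw [h]
        simp only [Nat.add_sub_cancel]
        push_cast
        field_simp
      · have hlt : ∀ D : Finset (Sym2 V),
            MeasurableSet {p : ℝ × (Sym2 V → ℝ) | ∀ f ∈ D, p.1 < p.2 f} := by
          intro D
          have : {p : ℝ × (Sym2 V → ℝ) | ∀ f ∈ D, p.1 < p.2 f} =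
              ⋂ f ∈ D, {p | p.1 < p.2 f} := by ext; simp
          rw [this]
          exact Finset.measurableSet_biInter _ fun f _ =>
            measurableSet_lt measurable_fst ((measurable_pi_apply f).comp measurable_snd)
        exact (measurable_fst measurableSet_Ioo).inter ((hlt D).inter
          ((measurable_snd (measurableSet_free S v 1)).inter (hlt S)))
      · intro τ ω ω' hω
        have h4 : ∀ f ∈ S, ω f = ω' f := fun f hf => hω f fun hf' => heS (hf' ▸ hf)
        have h5 : ∀ f ∈ D, ω f = ω' f := fun f hf => hω f fun hf' => heD (hf' ▸ hf)
        simp only [Set.mem_ofPred_eq, eq_iff_iff]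
        refine and_congr_right fun _ => and_congr (forall₂_congr fun f hf => ?_)
          (and_congr (free_congr h4) (forall₂_congr fun f hf => ?_))
        · rw [h5 f hf]
        · rw [h4 f hf]
  rw [measureReal_congr hA, measureReal_biUnion_finset hdisj fun e _ => hBmeas e,
    Finset.sum_congr rfl hBe, ← Finset.mul_sum, ← Finset.mul_sum, ← unmatchedProb_eq_sum hE]

theorem unmatchedProb_eq_weightMeasure_real [Fintype V] (E : Finset (Sym2 V)) (v : V) :
    unmatchedProb E v = (weightMeasure (Sym2 V)).real {ω | GreedyFree E ω v 1} := by
  have h := weightMeasure_real_free E v (s := 0) (by simp)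
  rw [sub_zero, one_pow, one_mul] at h
  rw [← h]
  refine measureReal_congr ?_
  have h2 : ∀ᵐ ω ∂weightMeasure (Sym2 V), ∀ e : Sym2 V, 0 < ω e := by
    rw [ae_all_iff]
    intro e
    have h := Measure.pi_eval_preimage_null (fun _ : Sym2 V => unitMeasure) (i := e)
      (s := Set.Iic 0) (by
        rw [unitMeasure, Measure.restrict_apply measurableSet_Iic]
        have : Set.Iic (0 : ℝ) ∩ Set.Ioc 0 1 = ∅ :=
          Set.eq_empty_of_forall_notMem fun x hx => absurd hx.1 (not_le.2 hx.2.1)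
        simp [this])
    rw [measure_eq_zero_iff_ae_notMem] at h
    filter_upwards [h] with ω hω
    simpa using hω
  filter_upwards [h2] with ω hω
  change (GreedyFree E ω v 1 ∧ ∀ f ∈ E, 0 < ω f) = GreedyFree E ω v 1
  exact propext (and_iff_left fun f _ => hω f)

end

/-! ### The tree recursion and its limit -/

/-- The probability that the root of a truncated tree whose nodes have `r - 1` children is
unmatched before time `t`, as a function of the truncation depth. -/
noncomputable def branchProb (r : ℕ) : ℕ → ℝ → ℝ
  | 0, _ => 1
  | n + 1, t => (1 - ∫ s in (0 : ℝ)..t, branchProb r n s) ^ (r - 1)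

/-- The probability that the root of a truncated `r`-regular tree is unmatched. -/
noncomputable def rootProb (r : ℕ) : ℕ → ℝ
  | 0 => 1
  | n + 1 => (1 - ∫ s in (0 : ℝ)..1, branchProb r n s) ^ r

/-- The limit of `branchProb`. -/
noncomputable def branchLimit (r : ℕ) (t : ℝ) : ℝ :=
  ((1 + ((r : ℝ) - 2) * t) ^ (-(1 / ((r : ℝ) - 2)))) ^ (r - 1)

theorem abs_pow_sub_pow_le_mul {a b : ℝ} (ha : a ∈ Set.Icc (0 : ℝ) 1) (hb : b ∈ Set.Icc (0 : ℝ) 1)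
    (n : ℕ) : |a ^ n - b ^ n| ≤ n * |a - b| := by
  refine (abs_pow_sub_pow_le a b n).trans ?_
  have h1 : max |a| |b| ^ (n - 1) ≤ 1 := by
    refine pow_le_one₀ (le_max_of_le_left (abs_nonneg a)) (max_le ?_ ?_)
    · rw [abs_of_nonneg ha.1]
      exact ha.2
    · rw [abs_of_nonneg hb.1]
      exact hb.2
  calc |a - b| * n * max |a| |b| ^ (n - 1) ≤ |a - b| * n * 1 := by gcongr
    _ = n * |a - b| := by ring

theorem one_sub_integral_mem_Icc {f : ℝ → ℝ} {t : ℝ} (ht : t ∈ Set.Icc (0 : ℝ) 1)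
    (hf : ∀ s ∈ Set.Icc (0 : ℝ) 1, f s ∈ Set.Icc (0 : ℝ) 1)
    (hi : IntervalIntegrable f volume 0 t) :
    1 - ∫ s in (0 : ℝ)..t, f s ∈ Set.Icc (0 : ℝ) 1 := by
  have h0 : 0 ≤ ∫ s in (0 : ℝ)..t, f s :=
    intervalIntegral.integral_nonneg ht.1 fun s hs => (hf s ⟨hs.1, hs.2.trans ht.2⟩).1
  have h1 : ∫ s in (0 : ℝ)..t, f s ≤ ∫ _ in (0 : ℝ)..t, (1 : ℝ) :=
    intervalIntegral.integral_mono_on ht.1 hi (by simp) fun s hs => (hf s ⟨hs.1, hs.2.trans ht.2⟩).2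
  simp only [intervalIntegral.integral_const, smul_eq_mul, mul_one, sub_zero] at h1
  exact ⟨by linarith [ht.2], by linarith⟩

theorem continuous_branchProb (r n : ℕ) : Continuous (branchProb r n) := by
  induction n with
  | zero => exact continuous_const
  | succ n ih =>
    exact (continuous_const.sub
      (intervalIntegral.continuous_primitive (fun a b => ih.intervalIntegrable a b) 0)).pow _

theorem branchProb_mem_Icc (r n : ℕ) {t : ℝ} (ht : t ∈ Set.Icc (0 : ℝ) 1) :
    branchProb r n t ∈ Set.Icc (0 : ℝ) 1 := by
  induction n generalizing t with
  | zero => simp [branchProb]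
  | succ n ih =>
    have h := one_sub_integral_mem_Icc ht (fun s hs => ih hs)
      ((continuous_branchProb r n).intervalIntegrable 0 t)
    exact ⟨pow_nonneg h.1 _, pow_le_one₀ h.1 h.2⟩

/-- The Picard step: integrating the bound raises the power of `t` and supplies the next factor of
the factorial. -/
theorem abs_integral_sub_le {f g : ℝ → ℝ} {q t : ℝ} {n : ℕ} (ht : t ∈ Set.Icc (0 : ℝ) 1)
    (hf : Continuous f) (hg : Continuous g)
    (h : ∀ s ∈ Set.Icc (0 : ℝ) 1, |f s - g s| ≤ (q * s) ^ n / (n.factorial : ℝ)) :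
    |(1 - ∫ s in (0 : ℝ)..t, f s) - (1 - ∫ s in (0 : ℝ)..t, g s)| ≤
      q ^ n * t ^ (n + 1) / ((n + 1).factorial : ℝ) := by
  have h1 : (1 - ∫ s in (0 : ℝ)..t, f s) - (1 - ∫ s in (0 : ℝ)..t, g s) =
      -∫ s in (0 : ℝ)..t, (f s - g s) := by
    rw [intervalIntegral.integral_sub (hf.intervalIntegrable _ _) (hg.intervalIntegrable _ _)]
    ring
  rw [h1, abs_neg]
  refine (intervalIntegral.abs_integral_le_integral_abs ht.1).trans ?_
  have h2 : ∫ s in (0 : ℝ)..t, |f s - g s| ≤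
      ∫ s in (0 : ℝ)..t, (q * s) ^ n / (n.factorial : ℝ) := by
    refine intervalIntegral.integral_mono_on ht.1 ?_ ?_ fun s hs => h s ⟨hs.1, hs.2.trans ht.2⟩
    · exact ((hf.sub hg).abs).intervalIntegrable _ _
    · exact (by fun_prop : Continuous fun s : ℝ =>
        (q * s) ^ n / (n.factorial : ℝ)).intervalIntegrable _ _
  refine h2.trans (le_of_eq ?_)
  simp only [mul_pow]
  rw [intervalIntegral.integral_div, intervalIntegral.integral_const_mul, integral_pow,
    Nat.factorial_succ]
  push_cast
  have : (n.factorial : ℝ) ≠ 0 := by positivity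
  field_simp
  simp

/-- The power `r - 1` is Lipschitz on [0, 1] with constant `r - 1`, so each iteration costs one
factor `r - 1`. -/
theorem abs_branchProb_succ_sub_le {r : ℕ} (hr : 1 ≤ r) (n : ℕ) {t : ℝ}
    (ht : t ∈ Set.Icc (0 : ℝ) 1) :
    |branchProb r (n + 1) t - branchProb r n t| ≤
      (((r : ℝ) - 1) * t) ^ (n + 1) / ((n + 1).factorial : ℝ) := by
  have hq : ((r - 1 : ℕ) : ℝ) = (r : ℝ) - 1 := by
    rw [Nat.cast_sub hr, Nat.cast_one]
  have hq0 : (0 : ℝ) ≤ (r : ℝ) - 1 := hq ▸ Nat.cast_nonneg _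
  induction n generalizing t with
  | zero =>
    have h := abs_pow_sub_pow_le_mul (a := 1 - t) (b := 1) ⟨by linarith [ht.2], by linarith [ht.1]⟩
      (by simp) (r - 1)
    rw [one_pow, hq] at h
    simp only [branchProb, intervalIntegral.integral_const, smul_eq_mul, mul_one, sub_zero]
    refine h.trans (le_of_eq ?_)
    rw [show (1 : ℝ) - t - 1 = -t by ring, abs_neg, abs_of_nonneg ht.1]
    simp
  | succ n ih =>
    have h := abs_pow_sub_pow_le_mul
      (one_sub_integral_mem_Icc ht (fun s hs => branchProb_mem_Icc r (n + 1) hs)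
        ((continuous_branchProb r (n + 1)).intervalIntegrable 0 t))
      (one_sub_integral_mem_Icc ht (fun s hs => branchProb_mem_Icc r n hs)
        ((continuous_branchProb r n).intervalIntegrable 0 t)) (r - 1)
    refine h.trans ?_
    rw [hq]
    refine (mul_le_mul_of_nonneg_left (abs_integral_sub_le ht (continuous_branchProb r (n + 1))
      (continuous_branchProb r n) fun s hs => ih hs) hq0).trans (le_of_eq ?_)
    rw [mul_pow]
    ring

theorem abs_rootProb_succ_sub_le {r : ℕ} (hr : 1 ≤ r) (n : ℕ) :
    |rootProb r (n + 1) - rootProb r n| ≤ r * ((r : ℝ) - 1) ^ n / ((n + 1).factorial : ℝ) := by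
  cases n with
  | zero =>
    -- Here `rootProb r 1 = (1 - 1) ^ r = 0`, and the claim becomes `1 ≤ r`.
    have h : (0 : ℝ) ^ r = 0 := zero_pow (by omega)
    simp [rootProb, branchProb, h]
    exact_mod_cast hr
  | succ n =>
    have h1 : (1 : ℝ) ∈ Set.Icc (0 : ℝ) 1 := by simp
    have h := abs_pow_sub_pow_le_mul
      (one_sub_integral_mem_Icc h1 (fun s hs => branchProb_mem_Icc r (n + 1) hs)
        ((continuous_branchProb r (n + 1)).intervalIntegrable 0 1))
      (one_sub_integral_mem_Icc h1 (fun s hs => branchProb_mem_Icc r n hs)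
        ((continuous_branchProb r n).intervalIntegrable 0 1)) r
    refine h.trans ?_
    refine (mul_le_mul_of_nonneg_left (abs_integral_sub_le h1 (continuous_branchProb r (n + 1))
      (continuous_branchProb r n) fun s hs => abs_branchProb_succ_sub_le hr n hs)
      (Nat.cast_nonneg r)).trans (le_of_eq ?_)
    rw [one_pow]
    ring

section

variable {r : ℕ} (hr : 3 ≤ r)
include hr

theorem one_add_mul_pos {t : ℝ} (ht : 0 ≤ t) : 0 < 1 + ((r : ℝ) - 2) * t := by
  have : (3 : ℝ) ≤ r := by exact_mod_cast hr
  have : 0 ≤ ((r : ℝ) - 2) * t := mul_nonneg (by linarith) ht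
  linarith

theorem branchLimit_eq {t : ℝ} (ht : 0 ≤ t) :
    branchLimit r t = (1 + ((r : ℝ) - 2) * t) ^ (-(1 / ((r : ℝ) - 2)) - 1) := by
  have h3 : (3 : ℝ) ≤ r := by exact_mod_cast hr
  have hq : ((r - 1 : ℕ) : ℝ) = (r : ℝ) - 1 := by
    rw [Nat.cast_sub (by omega), Nat.cast_one]
  rw [branchLimit, ← Real.rpow_natCast, ← Real.rpow_mul (one_add_mul_pos hr ht).le, hq]
  congr 1
  have : (r : ℝ) - 2 ≠ 0 := by linarith
  field_simp
  ring

theorem continuousOn_branchLimit : ContinuousOn (branchLimit r) (Set.Icc 0 1) := by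
  refine ContinuousOn.pow (ContinuousOn.rpow_const (by fun_prop) ?_) _
  exact fun t ht => Or.inl (one_add_mul_pos hr ht.1).ne'

/-- The right side y solves y' = -y^(r-1), y(0) = 1. As `branchLimit` is defined to be y^(r-1), this
is its fixed-point equation. -/
theorem integral_branchLimit {t : ℝ} (ht : t ∈ Set.Icc (0 : ℝ) 1) :
    1 - ∫ s in (0 : ℝ)..t, branchLimit r s = (1 + ((r : ℝ) - 2) * t) ^ (-(1 / ((r : ℝ) - 2))) := by
  have h3 : (3 : ℝ) ≤ r := by exact_mod_cast hr
  have h := intervalIntegral.integral_eq_sub_of_hasDerivAt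
    (f := fun s => -(1 + ((r : ℝ) - 2) * s) ^ (-(1 / ((r : ℝ) - 2)))) (f' := branchLimit r)
    (a := 0) (b := t) ?_ ?_
  · rw [h]
    simp
  · intro s hs
    rw [Set.uIcc_of_le ht.1] at hs
    have h1 : HasDerivAt (fun s : ℝ => 1 + ((r : ℝ) - 2) * s) ((r : ℝ) - 2) s := by
      simpa using ((hasDerivAt_id s).const_mul ((r : ℝ) - 2)).const_add 1
    have h2 := (h1.rpow_const (p := -(1 / ((r : ℝ) - 2)))
      (Or.inl (one_add_mul_pos hr hs.1).ne')).neg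
    refine h2.congr_deriv ?_
    rw [branchLimit_eq hr hs.1]
    have : (r : ℝ) - 2 ≠ 0 := by linarith
    field_simp
  · refine ContinuousOn.intervalIntegrable ?_
    rw [Set.uIcc_of_le ht.1]
    exact (continuousOn_branchLimit hr).mono (Set.Icc_subset_Icc_right ht.2)

theorem branchLimit_mem_Icc {t : ℝ} (ht : t ∈ Set.Icc (0 : ℝ) 1) :
    branchLimit r t ∈ Set.Icc (0 : ℝ) 1 := by
  have h3 : (3 : ℝ) ≤ r := by exact_mod_cast hr
  have h1 : 0 ≤ ((r : ℝ) - 2) * t := mul_nonneg (by linarith) ht.1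
  rw [branchLimit_eq hr ht.1]
  refine ⟨Real.rpow_nonneg (one_add_mul_pos hr ht.1).le _, ?_⟩
  refine Real.rpow_le_one_of_one_le_of_nonpos (by linarith) ?_
  have : 0 ≤ 1 / ((r : ℝ) - 2) := by
    apply one_div_nonneg.2
    linarith
  linarith

theorem intervalIntegrable_branchLimit {t : ℝ} (ht : t ∈ Set.Icc (0 : ℝ) 1) :
    IntervalIntegrable (branchLimit r) volume 0 t := by
  refine ContinuousOn.intervalIntegrable ?_
  rw [Set.uIcc_of_le ht.1]
  exact (continuousOn_branchLimit hr).mono (Set.Icc_subset_Icc_right ht.2)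

/-- The iteration reverses order, fixes `branchLimit` and starts at 1, which lies above it; so the
iterates alternate around it. -/
theorem branchLimit_le_and_ge (n : ℕ) {t : ℝ} (ht : t ∈ Set.Icc (0 : ℝ) 1) :
    (Even n → branchLimit r t ≤ branchProb r n t) ∧
      (Odd n → branchProb r n t ≤ branchLimit r t) := by
  induction n generalizing t with
  | zero => exact ⟨fun _ => (branchLimit_mem_Icc hr ht).2, fun h => absurd h (by decide)⟩
  | succ n ih =>
    have hb := one_sub_integral_mem_Icc ht (fun s hs => branchProb_mem_Icc r n hs)
      ((continuous_branchProb r n).intervalIntegrable 0 t)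
    have hl := one_sub_integral_mem_Icc ht (fun s hs => branchLimit_mem_Icc hr hs)
      (intervalIntegrable_branchLimit hr ht)
    have he : branchLimit r t = (1 - ∫ s in (0 : ℝ)..t, branchLimit r s) ^ (r - 1) := by
      rw [integral_branchLimit hr ht, branchLimit]
    rw [he, branchProb]
    constructor
    · intro hn
      refine pow_le_pow_left₀ hl.1 (sub_le_sub_left ?_ 1) _
      refine intervalIntegral.integral_mono_on ht.1
        ((continuous_branchProb r n).intervalIntegrable 0 t)
        (intervalIntegrable_branchLimit hr ht) fun s hs => ?_
      exact (ih ⟨hs.1, hs.2.trans ht.2⟩).2 (by simpa using Nat.even_add_one.1 hn)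
    · intro hn
      refine pow_le_pow_left₀ hb.1 (sub_le_sub_left ?_ 1) _
      refine intervalIntegral.integral_mono_on ht.1 (intervalIntegrable_branchLimit hr ht)
        ((continuous_branchProb r n).intervalIntegrable 0 t) fun s hs => ?_
      exact (ih ⟨hs.1, hs.2.trans ht.2⟩).1 (by simpa using Nat.odd_add_one.1 hn)

theorem rootLimit_le_and_ge (n : ℕ) :
    (Even n → ((r : ℝ) - 1) ^ (-((r : ℝ) / ((r : ℝ) - 2))) ≤ rootProb r n) ∧
      (Odd n → rootProb r n ≤ ((r : ℝ) - 1) ^ (-((r : ℝ) / ((r : ℝ) - 2)))) := by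
  have h1 : (1 : ℝ) ∈ Set.Icc (0 : ℝ) 1 := by simp
  have h3 : (3 : ℝ) ≤ r := by exact_mod_cast hr
  have he : ((r : ℝ) - 1) ^ (-((r : ℝ) / ((r : ℝ) - 2))) =
      (1 - ∫ s in (0 : ℝ)..1, branchLimit r s) ^ r := by
    rw [integral_branchLimit hr h1, ← Real.rpow_natCast, ← Real.rpow_mul (by linarith)]
    congr 1
    · ring
    · ring
  have hl := one_sub_integral_mem_Icc h1 (fun s hs => branchLimit_mem_Icc hr hs)
    (intervalIntegrable_branchLimit hr h1)
  rw [he]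
  cases n with
  | zero => exact ⟨fun _ => pow_le_one₀ hl.1 hl.2, fun h => absurd h (by decide)⟩
  | succ n =>
    have hb := one_sub_integral_mem_Icc h1 (fun s hs => branchProb_mem_Icc r n hs)
      ((continuous_branchProb r n).intervalIntegrable 0 1)
    constructor
    · intro hn
      refine pow_le_pow_left₀ hl.1 (sub_le_sub_left ?_ 1) _
      exact intervalIntegral.integral_mono_on zero_le_one
        ((continuous_branchProb r n).intervalIntegrable 0 1)
        (intervalIntegrable_branchLimit hr h1) fun s hs =>
          (branchLimit_le_and_ge hr n hs).2 (by simpa using Nat.even_add_one.1 hn)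
    · intro hn
      refine pow_le_pow_left₀ hb.1 (sub_le_sub_left ?_ 1) _
      exact intervalIntegral.integral_mono_on zero_le_one (intervalIntegrable_branchLimit hr h1)
        ((continuous_branchProb r n).intervalIntegrable 0 1) fun s hs =>
          (branchLimit_le_and_ge hr n hs).1 (by simpa using Nat.odd_add_one.1 hn)

end

/-! ### Local exploration in graphs of large girth -/

namespace SimpleGraph

variable {V : Type*} {G : SimpleGraph V}

/-- Two paths with the same endpoints whose lengths add up to less than the girth are equal. -/
theorem Walk.IsPath.eq_of_length_add_lt {g : ℕ} (hg : (g : ℕ∞) ≤ G.egirth) {u v : V}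
    {p q : G.Walk u v} (hp : p.IsPath) (hq : q.IsPath) (h : p.length + q.length < g) : p = q := by
  classical
  set H : SimpleGraph V := SimpleGraph.fromEdgeSet {e | e ∈ p.edges ∨ e ∈ q.edges} with hH
  have hHG : H ≤ G := by
    intro a b hab
    rw [hH, SimpleGraph.fromEdgeSet_adj] at hab
    rcases hab.1 with h1 | h1
    · exact p.adj_of_mem_edges h1
    · exact q.adj_of_mem_edges h1
  have hmem : ∀ e, e ∈ H.edgeSet → e ∈ p.edges ∨ e ∈ q.edges := by
    intro e he
    rw [hH, SimpleGraph.edgeSet_fromEdgeSet] at he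
    exact he.1
  have hpH : ∀ e ∈ p.edges, e ∈ H.edgeSet := by
    intro e he
    rw [hH, SimpleGraph.edgeSet_fromEdgeSet]
    exact ⟨Or.inl he, G.not_isDiag_of_mem_edgeSet (p.edges_subset_edgeSet he)⟩
  have hqH : ∀ e ∈ q.edges, e ∈ H.edgeSet := by
    intro e he
    rw [hH, SimpleGraph.edgeSet_fromEdgeSet]
    exact ⟨Or.inr he, G.not_isDiag_of_mem_edgeSet (q.edges_subset_edgeSet he)⟩
  -- A cycle in the union of the two paths has distinct edges, hence length at most `p.length +
  -- q.length`, below the girth.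
  have hacyc : H.IsAcyclic := by
    intro a c hc
    have h1 : c.edges.toFinset ⊆ (p.edges ++ q.edges).toFinset := by
      intro e he
      rw [List.mem_toFinset] at he ⊢
      exact List.mem_append.2 (hmem e (c.edges_subset_edgeSet he))
    have h2 := Finset.card_le_card h1
    rw [List.toFinset_card_of_nodup hc.edges_nodup, Walk.length_edges] at h2
    have h3 := (List.toFinset_card_le (p.edges ++ q.edges))
    rw [List.length_append, Walk.length_edges, Walk.length_edges] at h3
    have h4 := SimpleGraph.le_egirth.1 hg a (c.mapLe hHG) ((Walk.isCycle_mapLe hHG).2 hc)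
    rw [Walk.length_map] at h4
    have h5 : g ≤ c.length := by exact_mod_cast h4
    omega
  have := hacyc.subsingleton_path u v
  have h1 := Subsingleton.elim (⟨p.transfer H hpH, hp.transfer hpH⟩ : H.Path u v)
    ⟨q.transfer H hqH, hq.transfer hqH⟩
  refine Walk.ext_support ?_
  rw [← Walk.support_transfer p hpH, ← Walk.support_transfer q hqH]
  exact congrArg (fun p : H.Path u v => p.1.support) h1

/-- A version of `Walk.IsPath.eq_of_length_add_lt` for first steps. -/
theorem eq_of_mem_support {g : ℕ} (hg : (g : ℕ∞) ≤ G.egirth) {x y z a b c : V}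
    (hy : G.Adj x y) (hz : G.Adj x z) {p : G.Walk y b} {q : G.Walk z c} (hp : p.IsPath)
    (hq : q.IsPath) (hxp : x ∉ p.support) (hxq : x ∉ q.support) (ha : a ∈ p.support)
    (ha' : a ∈ q.support) (h : p.length + q.length + 2 < g) : y = z := by
  classical
  have h1 : (Walk.cons hy (p.takeUntil a ha)).IsPath := by
    rw [Walk.cons_isPath_iff]
    exact ⟨hp.takeUntil ha, fun hx => hxp (p.support_takeUntil_subset_support ha hx)⟩
  have h2 : (Walk.cons hz (q.takeUntil a ha')).IsPath := by
    rw [Walk.cons_isPath_iff]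
    exact ⟨hq.takeUntil ha', fun hx => hxq (q.support_takeUntil_subset_support ha' hx)⟩
  have h3 := h1.eq_of_length_add_lt hg h2 (by
    rw [Walk.length_cons, Walk.length_cons]
    have := p.length_takeUntil_le_length ha
    have := q.length_takeUntil_le_length ha'
    omega)
  have h4 := congrArg Walk.snd h3
  simpa using h4

/-- The event that `w` is unmatched before time `t` when the edges arrive at the times `ω`,
computed as in a tree in which `u` is the parent of `w`, down to depth `n`. -/
def branchFree (G : SimpleGraph V) (ω : Sym2 V → ℝ) : ℕ → V → V → ℝ → Prop
  | 0, _, _, _ => True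
  | n + 1, u, w, t =>
    ∀ x, G.Adj w x → x ≠ u → ω s(w, x) < t → ¬ branchFree G ω n w x (ω s(w, x))

/-- Ignoring the parent `u` is harmless because `ht` says that its edge has not arrived before `t`.
The inclusion reverses at each level, since the recursion negates. -/
theorem free_branchFree {E : Finset (Sym2 V)} (hE : ∀ e, e ∈ E ↔ e ∈ G.edgeSet)
    (ω : Sym2 V → ℝ) (n : ℕ) {u w : V} {t : ℝ} (ht : t ≤ ω s(u, w)) :
    (Even n → GreedyFree E ω w t → G.branchFree ω n u w t) ∧
      (Odd n → G.branchFree ω n u w t → GreedyFree E ω w t) := by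
  induction n generalizing u w t with
  | zero => exact ⟨fun _ _ => trivial, fun h => absurd h (by decide)⟩
  | succ n ih =>
    constructor
    · intro hn h x hx _ hxt hb
      refine free_iff.1 h x ((hE _).2 hx) hxt ?_
      exact (ih le_rfl).2 (by simpa using Nat.even_add_one.1 hn) hb
    · intro hn h
      refine free_iff.2 fun x hx hxt hf => ?_
      refine h x ((hE _).1 hx) ?_ hxt ((ih le_rfl).1 (by simpa using Nat.odd_add_one.1 hn) hf)
      rintro rfl
      rw [Sym2.eq_swap] at hxt
      exact absurd hxt ht.not_gt

variable [Fintype V]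

open Classical in
/-- The edge from `u` to `w` and the edges reached from it in at most `n` further steps. -/
noncomputable def branchEdges (G : SimpleGraph V) : ℕ → V → V → Finset (Sym2 V)
  | 0, u, w => {s(u, w)}
  | n + 1, u, w =>
    insert s(u, w) (((G.neighborFinset w).erase u).biUnion fun x => branchEdges G n w x)

theorem mem_branchEdges_self (n : ℕ) (u w : V) : s(u, w) ∈ G.branchEdges n u w := by
  cases n <;> simp [branchEdges]

theorem branchEdges_subset {n : ℕ} {u w x : V} (h : G.Adj w x) (hx : x ≠ u) :
    G.branchEdges n w x ⊆ G.branchEdges (n + 1) u w := by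
  classical
  intro e he
  rw [branchEdges]
  refine Finset.mem_insert_of_mem (Finset.mem_biUnion.2 ⟨x, ?_, he⟩)
  simp [h, hx]

theorem exists_path_of_mem_branchEdges {g n : ℕ} (hg : (g : ℕ∞) ≤ G.egirth) (hn : n + 1 < g)
    {u w : V} (h : G.Adj u w) {e : Sym2 V} (he : e ∈ G.branchEdges n u w) :
    ∃ c, ∃ p : G.Walk w c, p.IsPath ∧ u ∉ p.support ∧ p.length ≤ n ∧
      e ∈ (Walk.cons h p).edges := by
  classical
  have hnil : e = s(u, w) → ∃ c, ∃ p : G.Walk w c, p.IsPath ∧ u ∉ p.support ∧ p.length ≤ n ∧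
      e ∈ (Walk.cons h p).edges := by
    rintro rfl
    exact ⟨w, Walk.nil, Walk.IsPath.nil, by simpa using h.ne, by simp, by simp⟩
  induction n generalizing u w with
  | zero => exact hnil (by simpa [branchEdges] using he)
  | succ n ih =>
    rw [branchEdges, Finset.mem_insert, Finset.mem_biUnion] at he
    rcases he with he | ⟨x, hx, he⟩
    · exact hnil he
    rw [Finset.mem_erase, mem_neighborFinset] at hx
    obtain ⟨c, p, hp, hwp, hlen, hep⟩ := ih (by omega) hx.2 he (by
      rintro rfl
      exact ⟨x, Walk.nil, Walk.IsPath.nil, by simpa using hx.2.ne, by simp, by simp⟩)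
    refine ⟨c, Walk.cons hx.2 p, (Walk.cons_isPath_iff _ _).2 ⟨hp, hwp⟩, ?_, by simpa using hlen,
      by simp only [Walk.edges_cons, List.mem_cons] at hep ⊢; exact Or.inr hep⟩
    rw [Walk.support_cons, List.mem_cons, not_or]
    refine ⟨h.ne, fun hu => hx.1 ?_⟩
    -- If the path came back to `u`, it and the edge `wu` would be two short routes from `w` to `u`,
    -- forcing `x = u`.
    exact eq_of_mem_support hg hx.2 h.symm hp Walk.IsPath.nil hwp (by simpa using h.ne') hu
      (by simp) (by simp; omega)

theorem disjoint_branchEdges {g n : ℕ} (hg : (g : ℕ∞) ≤ G.egirth) (hn : 2 * (n + 1) < g)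
    {x y z : V} (hy : G.Adj x y) (hz : G.Adj x z) (hyz : y ≠ z) :
    Disjoint (G.branchEdges n x y) (G.branchEdges n x z) := by
  rw [Finset.disjoint_left]
  intro e he he'
  obtain ⟨b, p, hp, hxp, hlen, hep⟩ := exists_path_of_mem_branchEdges hg (by omega) hy he
  obtain ⟨c, q, hq, hxq, hlen', heq⟩ := exists_path_of_mem_branchEdges hg (by omega) hz he'
  have hdiag := G.not_isDiag_of_mem_edgeSet (Walk.edges_subset_edgeSet _ hep)
  -- A common edge has an endpoint other than `x`, and there the two short paths leaving `x` meet.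
  obtain ⟨a, hae, hax⟩ : ∃ a ∈ e, a ≠ x := by
    obtain ⟨a, a'⟩ := e
    by_cases hax : a = x
    · refine ⟨a', Sym2.mem_mk_right _ _, ?_⟩
      rintro rfl
      exact hdiag hax
    · exact ⟨a, Sym2.mem_mk_left _ _, hax⟩
  have h1 := Walk.mem_support_of_mem_edges hep hae
  have h2 := Walk.mem_support_of_mem_edges heq hae
  rw [Walk.support_cons, List.mem_cons] at h1 h2
  exact hyz (eq_of_mem_support hg hy hz hp hq hxp hxq (h1.resolve_left hax) (h2.resolve_left hax)
    (by omega))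

/-- The event lives on the branch without its stem `s(u, w)`. This exception is what allows the
stem's weight to be integrated out by Fubini. -/
theorem branchFree_congr {g n : ℕ} (hg : (g : ℕ∞) ≤ G.egirth) (hn : 2 * n < g) {u w : V}
    (h : G.Adj u w) {ω ω' : Sym2 V → ℝ}
    (hω : ∀ e ∈ G.branchEdges n u w, e ≠ s(u, w) → ω e = ω' e) (t : ℝ) :
    G.branchFree ω n u w t ↔ G.branchFree ω' n u w t := by
  induction n generalizing u w t with
  | zero => rfl
  | succ n ih =>
    rw [branchFree, branchFree]
    refine forall_congr' fun x => forall₂_congr fun hx hxu => ?_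
    have hne : ∀ e ∈ G.branchEdges n w x, e ≠ s(u, w) := by
      rintro e he rfl
      rw [Sym2.eq_swap] at he
      exact Finset.disjoint_left.1 (disjoint_branchEdges hg hn hx h.symm hxu) he
        (mem_branchEdges_self n w u)
    have hsub := branchEdges_subset (n := n) hx hxu
    rw [hω _ (hsub (mem_branchEdges_self n w x)) (hne _ (mem_branchEdges_self n w x))]
    rw [ih (by omega) hx fun e he _ => hω e (hsub he) (hne e he)]

theorem measurable_branchFree (G : SimpleGraph V) (n : ℕ) (u w : V) :
    Measurable fun p : ℝ × (Sym2 V → ℝ) => G.branchFree p.2 n u w p.1 := by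
  induction n generalizing u w with
  | zero => exact measurable_const
  | succ n ih =>
    simp only [branchFree]
    refine Measurable.forall fun x => measurable_const.imp (measurable_const.imp ?_)
    have h1 : Measurable fun p : ℝ × (Sym2 V → ℝ) => p.2 s(w, x) :=
      (measurable_pi_apply _).comp measurable_snd
    exact (measurableSet_setOfPred.1 (measurableSet_lt h1 measurable_fst)).imp
      ((ih w x).comp (h1.prodMk measurable_snd)).not

/-- Distinct branches use disjoint edge sets, hence are independent; each one blocks `w` with
probability ∫₀ᵗ f, by conditioning on the weight of its stem. Keeping `N` general covers both inner
nodes (`r - 1` children) and the root (`r` children). -/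
theorem weightMeasure_real_branches {g n : ℕ} (hg : (g : ℕ∞) ≤ G.egirth) (hn : 2 * (n + 1) < g)
    {w : V} (N : Finset V) (hN : ∀ x ∈ N, G.Adj w x) {t : ℝ} (ht : t ∈ Set.Icc (0 : ℝ) 1)
    {f : ℝ → ℝ} (hf : ∀ x ∈ N, ∀ s ∈ Set.Icc (0 : ℝ) 1,
      (weightMeasure (Sym2 V)).real {ω | G.branchFree ω n w x s} = f s) :
    (weightMeasure (Sym2 V)).real
        {ω | ∀ x ∈ N, ω s(w, x) < t → ¬ G.branchFree ω n w x (ω s(w, x))} =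
      (1 - ∫ s in (0 : ℝ)..t, f s) ^ N.card := by
  have hmeas : ∀ x, MeasurableSet
      {p : ℝ × (Sym2 V → ℝ) | p.1 < t ∧ G.branchFree p.2 n w x p.1} := fun x =>
    (measurableSet_lt measurable_fst measurable_const).inter
      (measurableSet_setOfPred.2 (measurable_branchFree G n w x))
  have hmeas' : ∀ x, MeasurableSet
      {ω : Sym2 V → ℝ | ω s(w, x) < t ∧ G.branchFree ω n w x (ω s(w, x))} := fun x =>
    (show Measurable fun ω : Sym2 V → ℝ => (ω s(w, x), ω) from
      (measurable_pi_apply s(w, x)).prodMk measurable_id) (hmeas x)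
  have hcompl : ∀ x, {ω : Sym2 V → ℝ | ω s(w, x) < t → ¬ G.branchFree ω n w x (ω s(w, x))} =
      {ω : Sym2 V → ℝ | ω s(w, x) < t ∧ G.branchFree ω n w x (ω s(w, x))}ᶜ := by
    intro x
    ext ω
    simp
  have h1 := weightMeasure_biInter N (fun x => G.branchEdges n w x)
    (fun x => {ω | ω s(w, x) < t → ¬ G.branchFree ω n w x (ω s(w, x))})
    (fun x hx y hy hxy => disjoint_branchEdges hg hn (hN x hx) (hN y hy) hxy)
    (fun x _ => (hcompl x) ▸ (hmeas' x).compl)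
    (fun x hx ω ω' hω => by
      simp only [Set.mem_ofPred_eq, eq_iff_iff]
      rw [hω _ (mem_branchEdges_self n w x),
        branchFree_congr hg (by omega) (hN x hx) fun e he _ => hω e he])
  rw [measureReal_def]
  refine (congrArg ENNReal.toReal h1).trans ?_
  rw [ENNReal.toReal_prod]
  refine Finset.prod_eq_pow_card fun x hx => ?_
  rw [← measureReal_def, hcompl, probReal_compl_eq_one_sub (hmeas' x)]
  congr 1
  refine (weightMeasure_real_eq_integral s(w, x) (hmeas x) ?_).trans ?_
  · intro s ω ω' hω
    simp only [Set.mem_ofPred_eq, eq_iff_iff]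
    exact and_congr_right fun _ =>
      branchFree_congr hg (by omega) (hN x hx) (fun e _ he => hω e he) s
  · rw [← integral_indicator_Ioo le_rfl ht.1 ht.2]
    rw [intervalIntegral.integral_of_le zero_le_one, intervalIntegral.integral_of_le zero_le_one]
    refine setIntegral_congr_fun measurableSet_Ioc fun s hs => ?_
    by_cases hst : s < t
    · rw [Set.indicator_of_mem (show s ∈ Set.Ioo 0 t from ⟨hs.1, hst⟩),
        ← hf x hx s ⟨hs.1.le, hs.2⟩]
      congr 1
      ext ω
      exact and_iff_right hst
    · rw [Set.indicator_of_notMem fun h => hst h.2]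
      have : {ω | (s, ω) ∈ {p : ℝ × (Sym2 V → ℝ) | p.1 < t ∧ G.branchFree p.2 n w x p.1}} = ∅ :=
        Set.eq_empty_of_forall_notMem fun ω h => hst h.1
      simp only [this, measureReal_empty]

open Classical in
theorem weightMeasure_real_branchFree {g n r : ℕ} (hg : (g : ℕ∞) ≤ G.egirth) (hn : 2 * n < g)
    (hreg : G.IsRegularOfDegree r) {u w : V} (h : G.Adj u w) {t : ℝ}
    (ht : t ∈ Set.Icc (0 : ℝ) 1) :
    (weightMeasure (Sym2 V)).real {ω | G.branchFree ω n u w t} = branchProb r n t := by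
  induction n generalizing u w t with
  | zero =>
    have : {ω : Sym2 V → ℝ | G.branchFree ω 0 u w t} = Set.univ :=
      Set.eq_univ_of_forall fun _ => trivial
    rw [this]
    simp [branchProb]
  | succ n ih =>
    have h1 := weightMeasure_real_branches hg hn ((G.neighborFinset w).erase u)
      (fun x hx => by simpa using (Finset.mem_erase.1 hx).2) ht (f := branchProb r n)
      (fun x hx s hs => ih (by omega) (by simpa using (Finset.mem_erase.1 hx).2) hs)
    rw [Finset.card_erase_of_mem (by simpa using h.symm), card_neighborFinset_eq_degree,
      hreg w] at h1
    rw [branchProb, ← h1]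
    congr 1
    ext ω
    simp only [Set.mem_ofPred_eq, Finset.mem_erase, mem_neighborFinset, branchFree]
    exact forall_congr' fun x => by tauto

-- At the root, each neighbour is examined exactly at the weight of its stem, so `free_branchFree`
-- applies with `le_rfl`.
open Classical in
theorem unmatchedProb_le_and_ge {g n r : ℕ} (hg : (g : ℕ∞) ≤ G.egirth) (hn : 2 * n < g)
    (hreg : G.IsRegularOfDegree r) (v : V) :
    (Even n → unmatchedProb G.edgeFinset v ≤ rootProb r n) ∧
      (Odd n → rootProb r n ≤ unmatchedProb G.edgeFinset v) := by
  have hE : ∀ e, e ∈ G.edgeFinset ↔ e ∈ G.edgeSet := fun e => mem_edgeFinset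
  rw [unmatchedProb_eq_weightMeasure_real]
  cases n with
  | zero => exact ⟨fun _ => measureReal_le_one, fun h => absurd h (by decide)⟩
  | succ n =>
    have h1 := weightMeasure_real_branches hg hn (G.neighborFinset v)
      (fun x hx => by simpa using hx) (t := 1) (by simp) (f := branchProb r n)
      (fun x hx s hs => weightMeasure_real_branchFree hg (by omega) hreg (by simpa using hx) hs)
    rw [card_neighborFinset_eq_degree, hreg v] at h1
    rw [rootProb, ← h1]
    constructor
    · intro hn'
      refine measureReal_mono fun ω hω x hx hxt hb => ?_
      refine free_iff.1 hω x ((hE _).2 (by simpa using hx)) hxt ?_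
      exact (free_branchFree hE ω n le_rfl).2 (by simpa using Nat.even_add_one.1 hn') hb
    · intro hn'
      refine measureReal_mono fun ω hω => free_iff.2 fun x hx hxt hf => ?_
      refine hω x (by simpa using hx) hxt ?_
      exact (free_branchFree hE ω n le_rfl).1 (by simpa using Nat.odd_add_one.1 hn') hf

/-! ### Error bounds and conclusion -/

open Classical in
theorem abs_unmatchedProb_sub_le {g n r : ℕ} (hr : 3 ≤ r) (hg : (g : ℕ∞) ≤ G.egirth)
    (hn : 2 * (n + 1) < g) (hreg : G.IsRegularOfDegree r) (v : V) :
    |unmatchedProb G.edgeFinset v - ((r : ℝ) - 1) ^ (-((r : ℝ) / ((r : ℝ) - 2)))| ≤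
      r * ((r : ℝ) - 1) ^ n / ((n + 1).factorial : ℝ) := by
  refine le_trans ?_ (abs_rootProb_succ_sub_le (by omega) n)
  have h1 := unmatchedProb_le_and_ge hg (n := n) (by omega) hreg v
  have h2 := unmatchedProb_le_and_ge hg (n := n + 1) hn hreg v
  have h3 := rootLimit_le_and_ge hr n
  have h4 := rootLimit_le_and_ge hr (n + 1)
  -- The probability and the limit both lie between `rootProb r n` and `rootProb r (n + 1)`; the
  -- parity of `n` decides which of these is the larger.
  rcases Nat.even_or_odd n with he | ho
  · have ho := he.add_one
    rw [abs_sub_comm (rootProb r (n + 1))]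
    refine le_trans ?_ (le_abs_self _)
    rw [abs_le]
    exact ⟨by linarith [h2.2 ho, h3.1 he], by linarith [h1.1 he, h4.2 ho]⟩
  · have he := ho.add_one
    refine le_trans ?_ (le_abs_self _)
    rw [abs_le]
    exact ⟨by linarith [h1.2 ho, h4.1 he], by linarith [h2.1 he, h3.2 ho]⟩

open Classical in
theorem abs_expectedGreedyMatchingRatio_sub_le [Nonempty V] {g r : ℕ} (hg4 : 4 ≤ g) (hr : 3 ≤ r)
    (hg : (g : ℕ∞) ≤ G.egirth) (hreg : G.IsRegularOfDegree r) :
    |expectedGreedyMatchingRatio G - (1 - ((r : ℝ) - 1) ^ (-((r : ℝ) / ((r : ℝ) - 2)))) / 2| ≤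
      (r : ℝ) * ((r : ℝ) - 1) ^ ((g - 2) / 2 : ℕ) / (((g - 2) / 2 : ℕ).factorial : ℝ) := by
  -- Possible since `4 ≤ g`; moreover `2 * (n + 1) ≤ g - 2`, so exploration to depth `n + 1` sees no
  -- cycle.
  obtain ⟨n, hn⟩ : ∃ n, (g - 2) / 2 = n + 1 := ⟨(g - 2) / 2 - 1, by omega⟩
  rw [hn]
  set c := ((r : ℝ) - 1) ^ (-((r : ℝ) / ((r : ℝ) - 2))) with hc
  have h3 : (3 : ℝ) ≤ r := by exact_mod_cast hr
  have hcard : (0 : ℝ) < Fintype.card V := by exact_mod_cast Fintype.card_pos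
  have h1 : expectedGreedyMatchingRatio G - (1 - c) / 2 =
      (∑ v : V, (c - unmatchedProb G.edgeFinset v) / 2) / Fintype.card V := by
    rw [expectedGreedyMatchingRatio_eq, sub_eq_iff_eq_add, ← sub_eq_iff_eq_add', ← sub_div,
      ← Finset.sum_sub_distrib, Finset.sum_congr rfl fun v _ => show
        (1 - unmatchedProb G.edgeFinset v) / 2 - (c - unmatchedProb G.edgeFinset v) / 2 =
          (1 - c) / 2 by ring, Finset.sum_const, Finset.card_univ, nsmul_eq_mul]
    field_simp
  rw [h1, abs_div, abs_of_pos hcard, div_le_iff₀ hcard]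
  refine (Finset.abs_sum_le_sum_abs _ _).trans ?_
  have h2 : ∀ v ∈ (Finset.univ : Finset V), |(c - unmatchedProb G.edgeFinset v) / 2| ≤
      (r : ℝ) * ((r : ℝ) - 1) ^ (n + 1) / ((n + 1).factorial : ℝ) := by
    intro v _
    have h4 := abs_unmatchedProb_sub_le hr hg (n := n) (by omega) hreg v
    rw [abs_div, abs_sub_comm, abs_two]
    -- The claimed bound has room to spare: a factor `r - 1` is given away here, and the factor 1/2
    -- below.
    have h5 : (r : ℝ) * ((r : ℝ) - 1) ^ n / ((n + 1).factorial : ℝ) ≤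
        (r : ℝ) * ((r : ℝ) - 1) ^ (n + 1) / ((n + 1).factorial : ℝ) := by
      gcongr
      · linarith
      · omega
    have h6 := abs_nonneg (unmatchedProb G.edgeFinset v - c)
    linarith
  refine (Finset.sum_le_sum h2).trans (le_of_eq ?_)
  rw [Finset.sum_const, Finset.card_univ, nsmul_eq_mul, mul_comm]

end SimpleGraph

theorem RegularGirthGraph.abs_expectedGreedyMatchingRatio_sub_le {g r : ℕ} (hg : 4 ≤ g)
    (hr : 3 ≤ r) (G : RegularGirthGraph.{u} g r) :
    |expectedGreedyMatchingRatio G.graph -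
        (1 - ((r : ℝ) - 1) ^ (-((r : ℝ) / ((r : ℝ) - 2)))) / 2| ≤
      (r : ℝ) * ((r : ℝ) - 1) ^ ((g - 2) / 2 : ℕ) / (((g - 2) / 2 : ℕ).factorial : ℝ) := by
  refine SimpleGraph.abs_expectedGreedyMatchingRatio_sub_le hg hr G.le_girth ?_
  convert G.regular

theorem theorem5 (g r : ℕ) (hg : 4 ≤ g) (hr : 3 ≤ r) :
    (((1 - ((r : ℝ) - 1) ^ (-((r : ℝ) / ((r : ℝ) - 2)))) / 2
        - (r : ℝ) * ((r : ℝ) - 1) ^ ((g - 2) / 2 : ℕ)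
          / (((g - 2) / 2 : ℕ).factorial : ℝ) : ℝ) : EReal)
      ≤ (⨅ G : RegularGirthGraph.{u} g r, ((expectedGreedyMatchingRatio G.graph : ℝ) : EReal)) ∧
    (⨅ G : RegularGirthGraph.{u} g r, ((expectedGreedyMatchingRatio G.graph : ℝ) : EReal))
      ≤ (⨆ G : RegularGirthGraph.{u} g r, ((expectedGreedyMatchingRatio G.graph : ℝ) : EReal)) ∧
    (⨆ G : RegularGirthGraph.{u} g r, ((expectedGreedyMatchingRatio G.graph : ℝ) : EReal))
      ≤ (((1 - ((r : ℝ) - 1) ^ (-((r : ℝ) / ((r : ℝ) - 2)))) / 2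
        + (r : ℝ) * ((r : ℝ) - 1) ^ ((g - 2) / 2 : ℕ)
          / (((g - 2) / 2 : ℕ).factorial : ℝ) : ℝ) : EReal) := by
  -- `iInf_le_iSup` relies on the instance `RegularGirthGraph.nonempty`.
  refine ⟨le_iInf fun G => EReal.coe_le_coe_iff.2 ?_, iInf_le_iSup,
    iSup_le fun G => EReal.coe_le_coe_iff.2 ?_⟩
  · have h := (abs_le.1 (G.abs_expectedGreedyMatchingRatio_sub_le hg hr)).1
    linarith
  · have h := (abs_le.1 (G.abs_expectedGreedyMatchingRatio_sub_le hg hr)).2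
    linarith
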